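/- **Conventions.** Formulas are first-order formulas with equality in the language $(0,1,+)$; $\bot,\to,\forall,=$ are primitive and the other connectives are the usual abbreviations. Proofs are natural-deduction proofs (trees of sequents $\Gamma\vdash\varphi$) for classical first-order logic with equality, whose leaves may also be axioms of the theory. The *size* (length) of a formula or a proof is its number of characters, a variable being a letter followed by its index in binary, and a proof consisting of all the sequents at its nodes. For a sentence $\sigma$ provable in $T$, let $\|\sigma\|_T$ be the least size of a $T$-proof of $\sigma$. Put $s\le t:\equiv\exists z\,(s+z=t)$ and $s<t:\equiv s\le t\wedge s\ne t$; write $m$ also for the numeral $1+(\dots+(1+1)\dots)$ and $mz$ for $z+(\dots+(z+z)\dots)$ ($m$ summands). **Theories.** $\mathsf{PrA}^-$ has as axioms: those of a cancellative Abelian semigroup with neutral element $0$ for $+$; $\forall x\; x+1\ne 0$; $\forall x\,(x\neq 0\to\exists y\;x=y+1)$; $\forall x,y\,(x\le y\vee y\le x)$. $\mathsf{PrA}$ is $\mathsf{PrA}^-$ together with (the universal closures of) all induction axioms $\varphi(0)\wedge\forall x(\varphi(x)\to\varphi(x+1))\to\forall x\,\varphi(x)$, where $\varphi$ may contain parameters.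 $\mathsf{PrA}_{\mathit{alt}}$ is $\mathsf{PrA}^-$ together with, for each prime $p$, the axiom $\forall x\,(x\equiv_p 0\vee\dots\vee x\equiv_p p-1)$, where $x\equiv_p s$ is $\exists z\,(pz+s=x\vee pz+x=s)$. **Formulas.** Let $\mathit{Mul}_0(x,y,z)$ be $$(y=0\to z=0)\wedge(y=1\to z=x)\wedge(y=2\to z=x+x)\wedge\neg(y\ne0\wedge y\ne1\wedge y\ne2),$$ and let $\mathit{Mul}_{n+1}(x,y,z)$ be $$\begin{aligned}\exists y_1,y_2,y_3,y_4,z_1,z_2,z_4\Big(&y=y_3+y_4\wedge{}\\ &\forall a,b,c\,\big((a,b,c)\in\{(y_1,y_2,y_3),(x,y_1,z_1),(z_1,y_2,z_2),(x,y_4,z_4)\}\to\mathit{Mul}_n(a,b,c)\big)\\ &\wedge z=z_2+z_4\wedge y_2<y_1\Big),\end{aligned}$$ where the membership abbreviates a disjunction of conjunctions of equalities. (So $\mathit{Mul}_n(x,y,z)$ expresses that $y\le 2^{2^n}$ and $x\cdot y=z$.) Let $\mathit{Hyp}_n(y)$ be the conjunction of $\mathit{Mul}_n(1,y,y)$, $\mathit{Mul}_n(0,y,0)$,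 $\forall x\,\exists!z\,\mathit{Mul}_n(x,y,z)$ and $$\forall x_0,x_1,x_2\big(x_0=x_1+x_2\to\exists z_0,z_1,z_2(\mathit{Mul}_n(x_1,y,z_1)\wedge\mathit{Mul}_n(x_2,y,z_2)\wedge\mathit{Mul}_n(x_0,y,z_0)\wedge z_0=z_1+z_2)\big),$$ and let $\mathit{Div}_n(x)$ be $$\forall y\big(\mathit{Hyp}_n(y)\to y=0\vee\exists a_1,b_1,b_2(\mathit{Mul}_n(a_1,y,b_1)\wedge x=b_1+b_2\wedge b_2<y)\big).$$ **Theorem (Speedup of $\mathsf{PrA}$ over $\mathsf{PrA}_{\mathit{alt}}$).** Let $\sigma_n$ be the sentence $\forall x\,\mathit{Div}_n(x)$. 1. There is a polynomial $P$ such that, for every $n\ge 0$, $\sigma_n$ has a $\mathsf{PrA}$-proof of size at most $P(n)$. 2. Every $\sigma_n$ is provable in $\mathsf{PrA}_{\mathit{alt}}$. 3. For every $n\ge0$, every $\mathsf{PrA}_{\mathit{alt}}$-proof of $\sigma_n$ uses an axiom of size greater than $2^{2^n-1}$, and has size greater than $2^{2^n-1}$. 4. The sentences $\sigma_n$ witness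 that $\mathsf{PrA}$ has a speedup of order $2^{2^{x^\varepsilon}}$ over $\mathsf{PrA}_{\mathit{alt}}$ for some real $\varepsilon>0$: all of them are provable in both theories, $\|\sigma_n\|_{\mathsf{PrA}}\to\infty$ as $n\to\infty$, and for all $n\ge 0$ $$2^{2^{\left(\|\sigma_n\|_{\mathsf{PrA}}\right)^{\varepsilon}}}\le\|\sigma_n\|_{\mathsf{PrA}_{\mathit{alt}}}.$$ -/

import Mathlib

open FirstOrder FirstOrder.Language

namespace ProofLength

universe u v

/-! ## Substitution

In Mathlib's `L.BoundedFormula α n` the variables are free variables `a : α` and variables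
`0, …, n - 1` (those quantified by the enclosing quantifiers, outermost first); the quantifier
`∀'` binds the variable `n` of a formula in `L.BoundedFormula α (n + 1)`. -/

section Substitution

variable {L : FirstOrder.Language.{u, v}} {α β : Type}

/-- Regard a term at depth `n` as a term at depth `n + 1` (variables keep their indices). -/
def liftTerm {n : ℕ} (t : L.Term (α ⊕ Fin n)) : L.Term (α ⊕ Fin (n + 1)) :=
  t.relabel (Sum.map id Fin.castSucc)

/-- Extension of a substitution to the scope of one more quantifier: the newly bound variable is
left alone. -/
def liftSubst {m n : ℕ} (s : α ⊕ Fin m → L.Term (β ⊕ Fin n)) :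
    α ⊕ Fin (m + 1) → L.Term (β ⊕ Fin (n + 1)) :=
  Sum.elim (fun a => liftTerm (s (Sum.inl a)))
    (Fin.lastCases (Term.var (Sum.inr (Fin.last n))) (fun i => liftTerm (s (Sum.inr i))))

/-- Simultaneous capture-avoiding substitution of terms for all the variables of a formula that
are not bound in it. -/
def substAll : {m : ℕ} → L.BoundedFormula α m → {n : ℕ} → (α ⊕ Fin m → L.Term (β ⊕ Fin n)) →
    L.BoundedFormula β n
  | _, .falsum, _, _ => .falsum
  | _, .equal t₁ t₂, _, s => .equal (t₁.subst s) (t₂.subst s)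
  | _, .rel R ts, _, s => .rel R (fun i => (ts i).subst s)
  | _, .imp φ ψ, _, s => .imp (substAll φ s) (substAll ψ s)
  | _, .all φ, _, s => .all (substAll φ (liftSubst s))

/-- `φ(t₀, …, t_{k-1})` for a formula `φ` in the variables `0, …, k - 1`. -/
def app {k n : ℕ} (φ : L.BoundedFormula Empty k) (t : Fin k → L.Term (Empty ⊕ Fin n)) :
    L.BoundedFormula Empty n :=
  substAll φ (Sum.elim Empty.elim t)

/-- `φ(t)` for a formula `φ` in one variable. -/
def app₁ {n : ℕ} (φ : L.BoundedFormula Empty 1) (t : L.Term (Empty ⊕ Fin n)) :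
    L.BoundedFormula Empty n :=
  app φ ![t]

/-- `φ(r, s, t)` for a formula `φ` in three variables. -/
def app₃ {n : ℕ} (φ : L.BoundedFormula Empty 3) (r s t : L.Term (Empty ⊕ Fin n)) :
    L.BoundedFormula Empty n :=
  app φ ![r, s, t]

/-- `φ(t)` for a formula `φ` with one distinguished variable (the variable `0`). -/
def inst (φ : L.BoundedFormula ℕ 1) (t : L.Term (ℕ ⊕ Fin 0)) : L.Formula ℕ :=
  substAll φ (Sum.elim (fun a => Term.var (Sum.inl a)) (fun _ => t))

/-- A sentence, regarded as a formula in which free variables `a₀, a₁, …` would be allowed. -/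
def ofSentence (σ : L.Sentence) : L.Formula ℕ :=
  substAll σ (Sum.elim Empty.elim Fin.elim0)

end Substitution

/-! ## Size: the number of characters

Function and relation symbols, `=`, `⊥`, `→`, `∀` are one character each, and prefix (Polish)
notation is used. A variable is a letter followed by its index written in binary (there are two
letters, one for free and one for bound variables); `Nat.size i` is the number of binary digits
of `i`. -/

section Size

variable {L : FirstOrder.Language.{u, v}}

/-- The number of characters of the variable with index `i`. -/
def varSize (i : ℕ) : ℕ := 1 + Nat.size i

/-- The number of characters of a term. -/
def termSize {n : ℕ} : L.Term (ℕ ⊕ Fin n) → ℕ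
  | .var (Sum.inl i) => varSize i
  | .var (Sum.inr j) => varSize j
  | .func _ ts => 1 + ∑ i, termSize (ts i)

/-- The number of characters of a formula. -/
def formulaSize : {n : ℕ} → L.BoundedFormula ℕ n → ℕ
  | _, .falsum => 1
  | _, .equal t₁ t₂ => 1 + termSize t₁ + termSize t₂
  | _, .rel _ ts => 1 + ∑ i, termSize (ts i)
  | _, .imp φ ψ => 1 + formulaSize φ + formulaSize ψ
  | n, .all φ => 1 + varSize n + formulaSize φ

/-- The number of characters of a sentence. -/
def sentenceSize (σ : L.Sentence) : ℕ := formulaSize (ofSentence σ)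

/-- The number of characters of a sequent `Γ ⊢ φ` (each formula of `Γ` is followed by one
separator). -/
def sequentSize (Γ : List (L.Formula ℕ)) (φ : L.Formula ℕ) : ℕ :=
  (Γ.map (fun γ => formulaSize γ + 1)).sum + formulaSize φ

end Size

/-! ## Natural deduction -/

section Calculus

variable {L : FirstOrder.Language.{u, v}}

/-- Natural-deduction proofs (trees of sequents) from the axioms of the theory `T`, for classical
first-order logic with equality, with the primitives `⊥`, `→`, `∀`, `=`. The other connectives are
the usual abbreviations in terms of these. -/
inductive Derivation (T : L.Theory) : List (L.Formula ℕ) → L.Formula ℕ → Type (max u v)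
  /-- A nonlogical axiom. -/
  | ax {Γ : List (L.Formula ℕ)} (σ : L.Sentence) (h : σ ∈ T) : Derivation T Γ (ofSentence σ)
  | hyp {Γ : List (L.Formula ℕ)} (φ : L.Formula ℕ) (h : φ ∈ Γ) : Derivation T Γ φ
  | impI {Γ : List (L.Formula ℕ)} {φ ψ : L.Formula ℕ}
      (d : Derivation T (φ :: Γ) ψ) : Derivation T Γ (φ.imp ψ)
  | impE {Γ : List (L.Formula ℕ)} {φ ψ : L.Formula ℕ}
      (d : Derivation T Γ (φ.imp ψ)) (e : Derivation T Γ φ) : Derivation T Γ ψ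
  /-- Proof by contradiction. -/
  | raa {Γ : List (L.Formula ℕ)} {φ : L.Formula ℕ}
      (d : Derivation T (φ.imp .falsum :: Γ) .falsum) : Derivation T Γ φ
  /-- Generalization, with the eigenvariable `a`. -/
  | allI {Γ : List (L.Formula ℕ)} {φ : L.BoundedFormula ℕ 1} (a : ℕ)
      (hφ : a ∉ φ.freeVarFinset) (hΓ : ∀ γ ∈ Γ, a ∉ BoundedFormula.freeVarFinset γ)
      (d : Derivation T Γ (inst φ (Term.var (Sum.inl a)))) : Derivation T Γ φ.all
  | allE {Γ : List (L.Formula ℕ)} {φ : L.BoundedFormula ℕ 1} (t : L.Term (ℕ ⊕ Fin 0))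
      (d : Derivation T Γ φ.all) : Derivation T Γ (inst φ t)
  | eqI {Γ : List (L.Formula ℕ)} (t : L.Term (ℕ ⊕ Fin 0)) : Derivation T Γ (.equal t t)
  | eqE {Γ : List (L.Formula ℕ)} (φ : L.BoundedFormula ℕ 1) {s t : L.Term (ℕ ⊕ Fin 0)}
      (d : Derivation T Γ (.equal s t)) (e : Derivation T Γ (inst φ s)) :
      Derivation T Γ (inst φ t)

/-- The number of characters of a derivation: the sum over all its nodes of the sizes of the
sequents written there. -/
def Derivation.size {T : L.Theory} :
    {Γ : List (L.Formula ℕ)} → {φ : L.Formula ℕ} → Derivation T Γ φ → ℕ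
  | Γ, _, .ax σ _ => sequentSize Γ (ofSentence σ)
  | Γ, _, .hyp φ _ => sequentSize Γ φ
  | Γ, _, .impI (φ := φ) (ψ := ψ) d => sequentSize Γ (φ.imp ψ) + d.size
  | Γ, _, .impE (ψ := ψ) d e => sequentSize Γ ψ + d.size + e.size
  | Γ, _, .raa (φ := φ) d => sequentSize Γ φ + d.size
  | Γ, _, .allI (φ := φ) _ _ _ d => sequentSize Γ φ.all + d.size
  | Γ, _, .allE (φ := φ) t d => sequentSize Γ (inst φ t) + d.size
  | Γ, _, .eqI t => sequentSize Γ (.equal t t)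
  | Γ, _, .eqE (t := t) φ d e => sequentSize Γ (inst φ t) + d.size + e.size

/-- The set of the nonlogical axioms that occur in a derivation. -/
def Derivation.used {T : L.Theory} :
    {Γ : List (L.Formula ℕ)} → {φ : L.Formula ℕ} → Derivation T Γ φ → Set L.Sentence
  | _, _, .ax σ _ => {σ}
  | _, _, .hyp _ _ => ∅
  | _, _, .impI d => d.used
  | _, _, .impE d e => d.used ∪ e.used
  | _, _, .raa d => d.used
  | _, _, .allI _ _ _ d => d.used
  | _, _, .allE _ d => d.used
  | _, _, .eqI _ => ∅
  | _, _, .eqE _ d e => d.used ∪ e.used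

/-- Proofs of a sentence in a theory. -/
abbrev Proof (T : L.Theory) (σ : L.Sentence) : Type (max u v) := Derivation T [] (ofSentence σ)

/-- `T` proves `σ`. -/
def Provable (T : L.Theory) (σ : L.Sentence) : Prop := Nonempty (Proof T σ)

/-- The size of the shortest proof of `σ` in `T` (meaningful only if `T` proves `σ`). -/
noncomputable def proofLength (T : L.Theory) (σ : L.Sentence) : ℕ :=
  sInf {s : ℕ | ∃ d : Proof T σ, d.size = s}

/-- The sentences `σ n` witness that `T` has a speedup of order `f` over `U`: all of them are
provable in both theories, the lengths of their shortest `T`-proofs tend to infinity, and the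
shortest `U`-proofs are longer by `f`. -/
def WitnessSpeedup (T U : L.Theory) (f : ℝ → ℝ) (σ : ℕ → L.Sentence) : Prop :=
  (∀ n, Provable T (σ n) ∧ Provable U (σ n)) ∧
  Filter.Tendsto (fun n => proofLength T (σ n)) Filter.atTop Filter.atTop ∧
  ∀ n, f (proofLength T (σ n)) ≤ (proofLength U (σ n) : ℝ)

end Calculus

/-! ## Presburger arithmetic -/

section Presburger

/-- The variable with index `i`, as a term of the language `0, 1, +`. -/
def x {n : ℕ} (i : Fin n) : presburger.Term (Empty ⊕ Fin n) := Term.var (Sum.inr i)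

/-- `t + (⋯ + (t + t)⋯)`, with `n` occurrences of `t` (and `0` for `n = 0`). -/
def mulNat {α : Type} (t : presburger.Term α) : ℕ → presburger.Term α
  | 0 => 0
  | 1 => t
  | n + 2 => t + mulNat t (n + 1)

/-- The numeral `1 + (⋯ + (1 + 1)⋯)`. -/
def numeral {α : Type} (n : ℕ) : presburger.Term α := mulNat 1 n

/-- `s ≤ t`, that is, `∃ z, s + z = t`. -/
def le {n : ℕ} (s t : presburger.Term (Empty ⊕ Fin n)) : presburger.BoundedFormula Empty n :=
  ∃' ((liftTerm s + x (Fin.last n)) =' liftTerm t)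

/-- `s < t`, that is, `s ≤ t` and `s ≠ t`. -/
def lt {n : ℕ} (s t : presburger.Term (Empty ⊕ Fin n)) : presburger.BoundedFormula Empty n :=
  le s t ⊓ ∼(s =' t)

/-- The axioms of `PrA⁻`: those of a cancellative Abelian semigroup with neutral element `0`;
`x + 1 ≠ 0`; every `x ≠ 0` is a successor; comparability. -/
def PrAMinus : presburger.Theory :=
  { ∀' ∀' ∀' (((x 0 + x 1) + x 2) =' (x 0 + (x 1 + x 2))),
    ∀' ∀' ((x 0 + x 1) =' (x 1 + x 0)),
    ∀' ((x 0 + 0) =' x 0),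
    ∀' ∀' ∀' (((x 0 + x 2) =' (x 1 + x 2)) ⟹ (x 0 =' x 1)),
    ∀' ∼((x 0 + 1) =' 0),
    ∀' (∼(x 0 =' 0) ⟹ ∃' (x 0 =' (x 1 + 1))),
    ∀' ∀' (le (x 0) (x 1) ⊔ le (x 1) (x 0)) }

/-- The induction axiom for the formula `φ`, with respect to its last variable; the variables
`0, …, k - 1` are parameters, and the universal closure is taken. -/
def induction {k : ℕ} (φ : presburger.BoundedFormula Empty (k + 1)) : presburger.Sentence :=
  ((app φ (Fin.lastCases 0 x) ⊓
      ∀' (φ ⟹ app φ (Fin.lastCases (x (Fin.last k) + 1) (fun i => x i.castSucc)))) ⟹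
    ∀' φ).alls

/-- `PrA`: the theory `PrA⁻` with the full schema of induction. -/
def PrA : presburger.Theory :=
  PrAMinus ∪ {σ | ∃ (k : ℕ) (φ : presburger.BoundedFormula Empty (k + 1)), σ = induction φ}

/-- `s ≡ t` modulo `m`, that is, `∃ z, (m z + t = s ∨ m z + s = t)`. -/
def modEq {n : ℕ} (m : ℕ) (s t : presburger.Term (Empty ⊕ Fin n)) :
    presburger.BoundedFormula Empty n :=
  ∃' (((mulNat (x (Fin.last n)) m + liftTerm t) =' liftTerm s) ⊔
      ((mulNat (x (Fin.last n)) m + liftTerm s) =' liftTerm t))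

/-- The disjunction `φ 0 ∨ ⋯ ∨ φ k`. -/
def disj {n : ℕ} (φ : ℕ → presburger.BoundedFormula Empty n) :
    ℕ → presburger.BoundedFormula Empty n
  | 0 => φ 0
  | k + 1 => disj φ k ⊔ φ (k + 1)

/-- The axiom `∀ x, (x ≡ 0 ∨ ⋯ ∨ x ≡ p - 1)` modulo `p`. -/
def modAxiom (p : ℕ) : presburger.Sentence :=
  ∀' disj (fun i => modEq p (x 0) (numeral i)) (p - 1)

/-- `PrA_alt`: the theory `PrA⁻` with the axioms of comparison modulo `p`, for all primes `p`. -/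
def PrAAlt : presburger.Theory :=
  PrAMinus ∪ {σ | ∃ p : ℕ, p.Prime ∧ σ = modAxiom p}

/-- `Mul₀(x, y, z)`, where `x, y, z` are the variables `0, 1, 2`. -/
def mulZero : presburger.BoundedFormula Empty 3 :=
  ((x 1 =' 0) ⟹ (x 2 =' 0)) ⊓
  (((x 1 =' 1) ⟹ (x 2 =' x 0)) ⊓
  (((x 1 =' numeral 2) ⟹ (x 2 =' (x 0 + x 0))) ⊓
  ∼(∼(x 1 =' 0) ⊓ (∼(x 1 =' 1) ⊓ ∼(x 1 =' numeral 2)))))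

/-- The formula
`∃ y₁ y₂ y₃ y₄ z₁ z₂ z₄, y = y₃ + y₄ ∧ M(y₁, y₂, y₃) ∧ M(x, y₁, z₁) ∧ M(z₁, y₂, z₂) ∧ M(x, y₄, z₄)`
`∧ z = z₂ + z₄ ∧ y₂ < y₁`,
with the four occurrences of `M` contracted to one:
`∀ a b c, ((a, b, c)` is one of the four triples `→ M(a, b, c))`.
The variables `0, …, 12` are `x, y, z, y₁, y₂, y₃, y₄, z₁, z₂, z₄, a, b, c`. -/
def mulStep (M : presburger.BoundedFormula Empty 3) : presburger.BoundedFormula Empty 3 :=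
  ∃' ∃' ∃' ∃' ∃' ∃' ∃' (
    (x 1 =' (x 5 + x 6)) ⊓
    ((∀' ∀' ∀' (
        (((x 10 =' x 3) ⊓ ((x 11 =' x 4) ⊓ (x 12 =' x 5))) ⊔
        (((x 10 =' x 0) ⊓ ((x 11 =' x 3) ⊓ (x 12 =' x 7))) ⊔
        (((x 10 =' x 7) ⊓ ((x 11 =' x 4) ⊓ (x 12 =' x 8))) ⊔
        ((x 10 =' x 0) ⊓ ((x 11 =' x 6) ⊓ (x 12 =' x 9)))))) ⟹
        app₃ M (x 10) (x 11) (x 12))) ⊓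
    ((x 2 =' (x 8 + x 9)) ⊓ lt (x 4) (x 3))))

/-- `Mulₙ(x, y, z)`, expressing that `y ≤ 2 ^ (2 ^ n)` and `x * y = z`. -/
def mul : ℕ → presburger.BoundedFormula Empty 3
  | 0 => mulZero
  | n + 1 => mulStep (mul n)

/-- `Hypₙ(y)`, where `y` is the variable `0`. -/
def hyp (n : ℕ) : presburger.BoundedFormula Empty 1 :=
  app₃ (mul n) 1 (x 0) (x 0) ⊓
  (app₃ (mul n) 0 (x 0) 0 ⊓
  ((∀' ∃' (app₃ (mul n) (x 1) (x 0) (x 2) ⊓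
      ∀' (app₃ (mul n) (x 1) (x 0) (x 3) ⟹ (x 3 =' x 2)))) ⊓
  ∀' ∀' ∀' ((x 1 =' (x 2 + x 3)) ⟹
    ∃' ∃' ∃' ((app₃ (mul n) (x 2) (x 0) (x 5) ⊓ app₃ (mul n) (x 3) (x 0) (x 6)) ⊓
      (app₃ (mul n) (x 1) (x 0) (x 4) ⊓ (x 4 =' (x 5 + x 6)))))))

/-- `Divₙ(x)`, where `x` is the variable `0`:
`∀ y, Hypₙ(y) → (y = 0 ∨ ∃ a₁ b₁ b₂, (Mulₙ(a₁, y, b₁) ∧ x = b₁ + b₂ ∧ b₂ < y))`. -/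
def div (n : ℕ) : presburger.BoundedFormula Empty 1 :=
  ∀' (app₁ (hyp n) (x 1) ⟹
    ((x 1 =' 0) ⊔
      ∃' ∃' ∃' (app₃ (mul n) (x 2) (x 1) (x 3) ⊓ ((x 0 =' (x 3 + x 4)) ⊓ lt (x 4) (x 1)))))

/-- The sentence `∀ x, Divₙ(x)`. -/
def divSentence (n : ℕ) : presburger.Sentence := ∀' (div n)

end Presburger

end ProofLength

/-!
# Presburger arithmetic has a speedup over its axiomatization by congruences

*Upper bound.* The formula `Div(x)` is inductive for formal reasons: whatever ternary relation `M`
stands in the place of `Mulₙ`, the hypothesis `Hyp(y)` gives `Div(0)` and `Div(x) → Div(x + 1)`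
(`IsMinusModel.divHolds_succ`). So in the language with a new ternary relation symbol there is one
fixed derivation of `∀ x, Div(x)` from `PrA⁻` and one induction axiom. Its existence comes from the
completeness theorem (`completeness`, by a Henkin construction in which variables serve as
witnesses). Replacing the new symbol by `Mulₙ` throughout turns this derivation into a `PrA`-proof
(`Derivation.exists_interpret`). Its size is at most a constant times the number of symbols of
`Mulₙ` (variables counting as one symbol) times one plus the quantifier depth of `Mulₙ`, because the
depth bounds the length of the bound variables. As `Mulₙ` occurs just once in `Mulₙ₊₁`, both parameters
grow linearly with `n`.

*Provability in `PrA_alt`.* In any model of `PrA⁻`, `Mulₙ(x, y, z)` holds if and only if `y` is a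
standard number `k ≤ 2 ^ 2 ^ n` and `z = k x` (`IsMinusModel.realize_mul`). Therefore `σₙ` says that
division with remainder by the nonzero standard numbers up to `2 ^ 2 ^ n` is possible
(`IsMinusModel.realize_divSentence_iff`). Division by primes is possible by the axioms of `PrA_alt`,
and division by a product reduces to division by the factors. The completeness theorem gives a
proof.

*Lower bound.* Let `p ≤ 2 ^ 2 ^ n` be prime. The nonnegative part of the lexicographically ordered
group `ℤ₍ₚ₎ × ℤ` (`localModel`) satisfies all the axioms of `PrA_alt` but the one for `p`, while
`(1, 0)` cannot be divided by `p` with a standard remainder, so that `σₙ` fails. By soundness, each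
`PrA_alt`-proof of `σₙ` uses the axiom for `p` (`modAxiom_mem_used`), which has more than `p`
symbols; by Bertrand's postulate some such `p` exceeds `2 ^ (2 ^ n - 1)`.

The speedup follows by comparing the double exponential with the polynomial (`exists_exponent`).
-/

namespace ProofLength

/-! ### Substitution -/

section SubstitutionLemmas

variable {L : FirstOrder.Language.{u, v}} {α β γ : Type}

theorem subst_subst {α β γ : Type*} (t : L.Term α) (f : α → L.Term β) (g : β → L.Term γ) :
    (t.subst f).subst g = t.subst (fun a => (f a).subst g) := by
  induction t with
  | var => rfl
  | func _ _ ih => simp [ih]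

theorem subst_var {α : Type*} (t : L.Term α) : t.subst Term.var = t := by
  induction t with
  | var => rfl
  | func _ _ ih => simp [ih]

theorem relabel_subst {α β γ : Type*} (t : L.Term α) (g : α → β) (s : β → L.Term γ) :
    (t.relabel g).subst s = t.subst (fun a => s (g a)) := by
  induction t with
  | var => rfl
  | func _ _ ih => simp [ih]

theorem subst_relabel {α β γ : Type*} (t : L.Term α) (s : α → L.Term β) (g : β → γ) :
    (t.subst s).relabel g = t.subst (fun a => (s a).relabel g) := by
  induction t with
  | var => rfl
  | func _ _ ih => simp [ih]

@[simp] theorem liftSubst_inl {m n : ℕ} (s : α ⊕ Fin m → L.Term (β ⊕ Fin n)) (a : α) :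
    liftSubst s (Sum.inl a) = liftTerm (s (Sum.inl a)) := rfl

@[simp] theorem liftSubst_castSucc {m n : ℕ} (s : α ⊕ Fin m → L.Term (β ⊕ Fin n)) (i : Fin m) :
    liftSubst s (Sum.inr i.castSucc) = liftTerm (s (Sum.inr i)) := by
  simp [liftSubst]

@[simp] theorem liftSubst_last {m n : ℕ} (s : α ⊕ Fin m → L.Term (β ⊕ Fin n)) :
    liftSubst s (Sum.inr (Fin.last m)) = Term.var (Sum.inr (Fin.last n)) := by
  simp [liftSubst]

theorem liftTerm_subst {m n : ℕ} (t : L.Term (α ⊕ Fin m)) (s : α ⊕ Fin m → L.Term (β ⊕ Fin n)) :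
    (liftTerm t).subst (liftSubst s) = liftTerm (t.subst s) := by
  rw [liftTerm, relabel_subst, liftTerm, subst_relabel]
  congr 1
  funext a
  rcases a with a | i
  · rfl
  · exact liftSubst_castSucc s i

/-- To check an equation between substitutions under a quantifier it suffices to look at the free
variables, the old bound variables and the newly bound variable. -/
theorem substitution_ext {m : ℕ} {X : Type*} {f g : α ⊕ Fin (m + 1) → X}
    (h₁ : ∀ a, f (Sum.inl a) = g (Sum.inl a))
    (h₂ : ∀ i : Fin m, f (Sum.inr i.castSucc) = g (Sum.inr i.castSucc))
    (h₃ : f (Sum.inr (Fin.last m)) = g (Sum.inr (Fin.last m))) : f = g := by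
  funext a
  rcases a with a | i
  · exact h₁ a
  · induction i using Fin.lastCases with
    | last => exact h₃
    | cast i => exact h₂ i

theorem liftSubst_comp {l m n : ℕ} (s : α ⊕ Fin l → L.Term (β ⊕ Fin m))
    (s' : β ⊕ Fin m → L.Term (γ ⊕ Fin n)) :
    (fun a => (liftSubst s a).subst (liftSubst s')) = liftSubst (fun a => (s a).subst s') := by
  apply substitution_ext <;> simp [liftTerm_subst]

theorem liftSubst_var {m : ℕ} :
    liftSubst (Term.var : α ⊕ Fin m → L.Term (α ⊕ Fin m)) = Term.var := by
  apply substitution_ext <;> simp [liftTerm]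

theorem substAll_substAll {l : ℕ} (φ : L.BoundedFormula α l) : ∀ {m n : ℕ}
    (s : α ⊕ Fin l → L.Term (β ⊕ Fin m)) (s' : β ⊕ Fin m → L.Term (γ ⊕ Fin n)),
    substAll (substAll φ s) s' = substAll φ (fun a => (s a).subst s') := by
  induction φ with
  | falsum => intros; rfl
  | equal t₁ t₂ => intros; simp [substAll, subst_subst]
  | rel R ts => intros; simp [substAll, subst_subst]
  | imp _ _ ih₁ ih₂ => intros; simp [substAll, ih₁, ih₂]
  | all _ ih => intros; simp [substAll, ih, liftSubst_comp]

theorem substAll_var {m : ℕ} (φ : L.BoundedFormula α m) : substAll φ Term.var = φ := by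
  induction φ with
  | falsum => rfl
  | equal t₁ t₂ => simp [substAll, subst_var]
  | rel R ts => simp [substAll, subst_var]
  | imp _ _ ih₁ ih₂ => simp [substAll, ih₁, ih₂]
  | all _ ih => simp [substAll, liftSubst_var, ih]

theorem subst_congr_left [DecidableEq α] {X : Type*} {Y : Type*} (t : L.Term (α ⊕ X))
    {s s' : α ⊕ X → L.Term Y} (h : ∀ a ∈ t.varFinsetLeft, s (Sum.inl a) = s' (Sum.inl a))
    (h' : ∀ i, s (Sum.inr i) = s' (Sum.inr i)) : t.subst s = t.subst s' := by
  induction t with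
  | var a =>
    rcases a with a | i
    · exact h a (by simp)
    · exact h' i
  | func f ts ih =>
    simp only [Term.subst, Term.func.injEq, heq_eq_eq, true_and]
    funext i
    exact ih i fun a ha => h a (by simpa using ⟨i, ha⟩)

theorem substAll_congr [DecidableEq α] {m : ℕ} (φ : L.BoundedFormula α m) : ∀ {n : ℕ}
    {s s' : α ⊕ Fin m → L.Term (β ⊕ Fin n)}
    (_ : ∀ a ∈ φ.freeVarFinset, s (Sum.inl a) = s' (Sum.inl a))
    (_ : ∀ i, s (Sum.inr i) = s' (Sum.inr i)), substAll φ s = substAll φ s' := by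
  induction φ with
  | falsum => intros; rfl
  | equal t₁ t₂ =>
    intro n s s' h h'
    simp only [BoundedFormula.freeVarFinset, Finset.mem_union] at h
    simp only [substAll]
    rw [subst_congr_left t₁ (fun a ha => h a (.inl ha)) h',
      subst_congr_left t₂ (fun a ha => h a (.inr ha)) h']
  | rel R ts =>
    intro n s s' h h'
    simp only [substAll, BoundedFormula.rel.injEq, heq_eq_eq, true_and]
    funext i
    exact subst_congr_left _ (fun a ha => h a (by simpa using ⟨i, ha⟩)) h'
  | imp _ _ ih₁ ih₂ =>
    intro n s s' h h'
    simp only [BoundedFormula.freeVarFinset, Finset.mem_union] at h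
    simp only [substAll]
    rw [ih₁ (fun a ha => h a (.inl ha)) h', ih₂ (fun a ha => h a (.inr ha)) h']
  | all _ ih =>
    intro n s s' h h'
    refine congrArg BoundedFormula.all (ih (fun a ha => ?_) fun i => ?_)
    · rw [liftSubst_inl, liftSubst_inl, h a ha]
    · induction i using Fin.lastCases with
      | last => simp
      | cast i => simp [h' i]

theorem mem_varFinsetLeft_subst [DecidableEq β] {X Y : Type*} {a : β} (t : L.Term X)
    (s : X → L.Term (β ⊕ Y)) (h : a ∈ (t.subst s).varFinsetLeft) :
    ∃ b, a ∈ (s b).varFinsetLeft := by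
  induction t with
  | var b => exact ⟨b, h⟩
  | func f ts ih =>
    simp only [Term.subst, Term.varFinsetLeft, Finset.mem_biUnion, Finset.mem_univ, true_and] at h
    obtain ⟨i, hi⟩ := h
    exact ih i hi

theorem varFinsetLeft_liftTerm [DecidableEq α] {n : ℕ} (t : L.Term (α ⊕ Fin n)) :
    (liftTerm t).varFinsetLeft = t.varFinsetLeft := by
  unfold liftTerm
  induction t with
  | var a => rcases a with a | i <;> rfl
  | func f ts ih => simp [ih]

theorem mem_freeVarFinset_substAll [DecidableEq β] {m : ℕ} {a : β} (φ : L.BoundedFormula α m) :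
    ∀ {n : ℕ} (s : α ⊕ Fin m → L.Term (β ⊕ Fin n)) (_ : a ∈ (substAll φ s).freeVarFinset),
      ∃ b, a ∈ (s b).varFinsetLeft := by
  induction φ with
  | falsum => intro n s h; simp [substAll] at h
  | equal t₁ t₂ =>
    intro n s h
    simp only [substAll, BoundedFormula.freeVarFinset, Finset.mem_union] at h
    exact h.elim (mem_varFinsetLeft_subst _ _) (mem_varFinsetLeft_subst _ _)
  | rel R ts =>
    intro n s h
    simp only [substAll, BoundedFormula.freeVarFinset, Finset.mem_biUnion, Finset.mem_univ,
      true_and] at h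
    obtain ⟨i, hi⟩ := h
    exact mem_varFinsetLeft_subst _ _ hi
  | imp _ _ ih₁ ih₂ =>
    intro n s h
    simp only [substAll, BoundedFormula.freeVarFinset, Finset.mem_union] at h
    exact h.elim (ih₁ s) (ih₂ s)
  | all _ ih =>
    intro n s h
    obtain ⟨b, hb⟩ := ih (liftSubst s) h
    rcases b with b | i
    · exact ⟨Sum.inl b, by rwa [liftSubst_inl, varFinsetLeft_liftTerm] at hb⟩
    · induction i using Fin.lastCases with
      | last => simp at hb
      | cast i => exact ⟨Sum.inr i, by rwa [liftSubst_castSucc, varFinsetLeft_liftTerm] at hb⟩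

theorem inst_eq (φ : L.BoundedFormula ℕ 1) (t : L.Term (ℕ ⊕ Fin 0)) :
    inst φ t = substAll φ (Sum.elim (fun a => Term.var (Sum.inl a)) (fun _ => t)) := rfl

theorem liftTerm_subst_inst (r t : L.Term (ℕ ⊕ Fin 0)) :
    (liftTerm r).subst (Sum.elim (fun a => Term.var (Sum.inl a)) (fun _ => t)) = r := by
  rw [liftTerm, relabel_subst]
  conv_rhs => rw [← subst_var r]
  congr 1
  funext a
  rcases a with a | i
  · rfl
  · exact i.elim0

/-- Instantiating the body of a quantified substitution instance. -/
theorem inst_substAll_liftSubst {m : ℕ} (φ : L.BoundedFormula α (m + 1))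
    (s : α ⊕ Fin m → L.Term (ℕ ⊕ Fin 0)) (t : L.Term (ℕ ⊕ Fin 0)) :
    inst (substAll φ (liftSubst s)) t =
      substAll φ (Sum.elim (fun a => s (Sum.inl a)) (Fin.snoc (fun i => s (Sum.inr i)) t :
        Fin (m + 1) → L.Term (ℕ ⊕ Fin 0))) := by
  rw [inst_eq, substAll_substAll]
  congr 1
  apply substitution_ext <;> simp [liftTerm_subst_inst]

theorem substAll_inst (φ : L.BoundedFormula ℕ 1) (t : L.Term (ℕ ⊕ Fin 0))
    (s : ℕ ⊕ Fin 0 → L.Term (ℕ ⊕ Fin 0)) :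
    substAll (inst φ t) s = inst (substAll φ (liftSubst s)) (t.subst s) := by
  rw [inst_substAll_liftSubst, inst_eq, substAll_substAll]
  congr 1
  apply substitution_ext
  · simp
  · exact fun i => i.elim0
  · exact (Fin.snoc_last (α := fun _ : Fin 1 => L.Term (ℕ ⊕ Fin 0)) (t.subst s)
      (fun i => s (Sum.inr i))).symm

theorem substAll_ofSentence (σ : L.Sentence) (s : ℕ ⊕ Fin 0 → L.Term (ℕ ⊕ Fin 0)) :
    substAll (ofSentence σ) s = ofSentence σ := by
  rw [ofSentence, substAll_substAll]
  congr 1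
  funext a
  rcases a with a | i
  · exact a.elim
  · exact i.elim0

section Realize

variable {M : Type*} [L.Structure M]

theorem realize_liftTerm {n : ℕ} (t : L.Term (α ⊕ Fin n)) (v : α → M) (xs : Fin (n + 1) → M) :
    (liftTerm t).realize (Sum.elim v xs) = t.realize (Sum.elim v (fun i => xs i.castSucc)) := by
  rw [liftTerm, Term.realize_relabel]
  congr 1
  funext a
  rcases a with a | i <;> rfl

@[simp] theorem realize_liftTerm_snoc {n : ℕ} (t : L.Term (α ⊕ Fin n)) (v : α → M) (xs : Fin n → M)
    (b : M) :
    (liftTerm t).realize (Sum.elim v (Fin.snoc xs b : Fin (n + 1) → M)) =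
      t.realize (Sum.elim v xs) := by
  rw [realize_liftTerm]
  simp

theorem realize_substAll {m : ℕ} (φ : L.BoundedFormula α m) : ∀ {n : ℕ}
    (s : α ⊕ Fin m → L.Term (β ⊕ Fin n)) (v : β → M) (xs : Fin n → M),
    (substAll φ s).Realize v xs ↔
      φ.Realize (fun a => (s (Sum.inl a)).realize (Sum.elim v xs))
        (fun i => (s (Sum.inr i)).realize (Sum.elim v xs)) := by
  have key : ∀ {m n : ℕ} (s : α ⊕ Fin m → L.Term (β ⊕ Fin n)) (v : β → M) (xs : Fin n → M),
      (Sum.elim (fun a => (s (Sum.inl a)).realize (Sum.elim v xs))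
        (fun i => (s (Sum.inr i)).realize (Sum.elim v xs)) : α ⊕ Fin m → M) =
      fun a => (s a).realize (Sum.elim v xs) := by
    intro m n s v xs
    funext a
    rcases a with a | i <;> rfl
  induction φ with
  | falsum => intros; rfl
  | equal t₁ t₂ =>
    intro n s v xs
    simp only [substAll, BoundedFormula.Realize, Term.realize_subst, key]
  | rel R ts =>
    intro n s v xs
    simp only [substAll, BoundedFormula.Realize, Term.realize_subst, key]
  | imp _ _ ih₁ ih₂ =>
    intro n s v xs
    simp only [substAll, BoundedFormula.realize_imp, ih₁, ih₂]
  | all φ ih =>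
    intro n s v xs
    simp only [substAll, BoundedFormula.realize_all, ih]
    refine forall_congr' fun b => ?_
    simp only [liftSubst_inl, realize_liftTerm_snoc]
    refine iff_of_eq (congrArg _ ?_)
    funext i
    induction i using Fin.lastCases with
    | last => simp
    | cast i => simp

theorem realize_inst (φ : L.BoundedFormula ℕ 1) (t : L.Term (ℕ ⊕ Fin 0)) (v : ℕ → M)
    (xs : Fin 0 → M) :
    BoundedFormula.Realize (inst φ t) v xs ↔
      φ.Realize v (Fin.snoc xs (t.realize (Sum.elim v xs))) := by
  rw [inst_eq, realize_substAll]
  refine iff_of_eq (congrArg _ ?_)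
  funext i
  rw [Subsingleton.elim i (Fin.last 0)]
  exact (Fin.snoc_last (α := fun _ : Fin 1 => M) (t.realize (Sum.elim v xs)) xs).symm

theorem realize_ofSentence (σ : L.Sentence) (v : ℕ → M) (xs : Fin 0 → M) :
    BoundedFormula.Realize (ofSentence σ) v xs ↔ M ⊨ σ := by
  rw [ofSentence, realize_substAll, Sentence.Realize, Formula.Realize]
  refine iff_of_eq (congrArg₂ _ ?_ ?_)
  · funext a; exact a.elim
  · funext i; exact i.elim0

theorem realize_app {k n : ℕ} (φ : L.BoundedFormula Empty k) (t : Fin k → L.Term (Empty ⊕ Fin n))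
    (v : Empty → M) (xs : Fin n → M) :
    (app φ t).Realize v xs ↔ φ.Realize v (fun i => (t i).realize (Sum.elim v xs)) := by
  rw [app, realize_substAll]
  refine iff_of_eq (congrArg₂ _ ?_ rfl)
  funext a; exact a.elim

end Realize

end SubstitutionLemmas

/-! ### Soundness and completeness of the calculus -/

section Completeness

variable {L : FirstOrder.Language.{u, v}} {T : L.Theory}

theorem realize_congr_freeVars {α : Type*} [DecidableEq α] {M : Type*} [L.Structure M] {n : ℕ}
    (φ : L.BoundedFormula α n) {v w : α → M} (h : ∀ a ∈ φ.freeVarFinset, v a = w a)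
    (xs : Fin n → M) : φ.Realize v xs ↔ φ.Realize w xs := by
  have h₁ := BoundedFormula.realize_restrictFreeVar (φ := φ) (f := id) (v := fun a => v a)
    (xs := xs) v (fun _ => rfl)
  have h₂ := BoundedFormula.realize_restrictFreeVar (φ := φ) (f := id) (v := fun a => v a)
    (xs := xs) w (fun a => h a a.2)
  exact h₁.symm.trans h₂

/-- Soundness, with respect to structures that satisfy merely those axioms which occur in the
derivation. -/
theorem Derivation.sound {M : Type*} [L.Structure M] {Γ : List (L.Formula ℕ)} {φ : L.Formula ℕ}
    (d : Derivation T Γ φ) (hd : ∀ σ ∈ d.used, M ⊨ σ) (v : ℕ → M) (xs : Fin 0 → M)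
    (hΓ : ∀ γ ∈ Γ, BoundedFormula.Realize γ v xs) : BoundedFormula.Realize φ v xs := by
  induction d generalizing v with
  | ax σ h => exact (realize_ofSentence σ v xs).2 (hd σ rfl)
  | hyp φ h => exact hΓ φ h
  | impI d ih =>
    intro h
    exact ih hd v (List.forall_mem_cons.2 ⟨h, hΓ⟩)
  | impE d e ihd ihe =>
    exact ihd (fun σ h => hd σ (.inl h)) v hΓ (ihe (fun σ h => hd σ (.inr h)) v hΓ)
  | raa d ih =>
    by_contra h
    exact ih hd v (List.forall_mem_cons.2 ⟨fun h' => (h h').elim, hΓ⟩)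
  | @allI Γ φ a hφ hΓa d ih =>
    intro b
    have hv : ∀ {n : ℕ} (ψ : L.BoundedFormula ℕ n) (xs : Fin n → M), a ∉ ψ.freeVarFinset →
        (ψ.Realize (Function.update v a b) xs ↔ ψ.Realize v xs) := fun ψ xs hψ =>
      realize_congr_freeVars ψ (fun c hc => Function.update_of_ne (a := c) (a' := a)
        (by rintro rfl; exact hψ hc) _ _) xs
    have := ih hd (Function.update v a b) fun γ hγ => (hv γ xs (hΓa γ hγ)).2 (hΓ γ hγ)
    rw [realize_inst, hv _ _ hφ, Term.realize_var, Sum.elim_inl, Function.update_self] at this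
    exact this
  | allE t d ih =>
    exact (realize_inst _ _ _ _).2 (ih hd v hΓ _)
  | eqI t => exact rfl
  | @eqE Γ φ s t d e ihd ihe =>
    have h₁ : s.realize (Sum.elim v xs) = t.realize (Sum.elim v xs) :=
      ihd (fun σ h => hd σ (.inl h)) v hΓ
    have h₂ := (realize_inst _ _ _ _).1 (ihe (fun σ h => hd σ (.inr h)) v hΓ)
    rw [realize_inst, ← h₁]
    exact h₂

/-- `φ` is derivable from the hypotheses `Γ` and the axioms of `T`. -/
def Derivable (T : L.Theory) (Γ : List (L.Formula ℕ)) (φ : L.Formula ℕ) : Prop :=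
  Nonempty (Derivation T Γ φ)

namespace Derivable

variable {Γ Δ : List (L.Formula ℕ)} {φ ψ : L.Formula ℕ}

theorem hyp (h : φ ∈ Γ) : Derivable T Γ φ := ⟨.hyp φ h⟩

theorem impI (h : Derivable T (φ :: Γ) ψ) : Derivable T Γ (φ.imp ψ) := h.map .impI

theorem impE (h : Derivable T Γ (φ.imp ψ)) (h' : Derivable T Γ φ) : Derivable T Γ ψ :=
  h.elim fun d => h'.map d.impE

theorem raa (h : Derivable T (φ.imp .falsum :: Γ) .falsum) : Derivable T Γ φ := h.map .raa

end Derivable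

theorem exists_fresh (F : Finset ℕ) (Γ : List (L.Formula ℕ)) :
    ∃ b, b ∉ F ∧ ∀ γ ∈ Γ, b ∉ BoundedFormula.freeVarFinset γ := by
  classical
  obtain ⟨b, hb⟩ := Infinite.exists_notMem_finset
    (F ∪ Γ.toFinset.biUnion (fun γ => BoundedFormula.freeVarFinset γ))
  simp only [Finset.mem_union, Finset.mem_biUnion, List.mem_toFinset, not_or, not_exists,
    not_and] at hb
  exact ⟨b, hb⟩

/-- Terms may be substituted for the free variables of a derivation, and hypotheses added. The
eigenvariables are renamed, to keep them apart from the new terms and hypotheses. -/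
theorem Derivation.substAll {Γ : List (L.Formula ℕ)} {φ : L.Formula ℕ} (d : Derivation T Γ φ)
    (s : ℕ ⊕ Fin 0 → L.Term (ℕ ⊕ Fin 0)) (Δ : List (L.Formula ℕ))
    (h : ∀ γ ∈ Γ, ProofLength.substAll γ s ∈ Δ) : Derivable T Δ (ProofLength.substAll φ s) := by
  induction d generalizing s Δ with
  | ax σ hσ => rw [substAll_ofSentence]; exact ⟨.ax σ hσ⟩
  | hyp φ hφ => exact .hyp (h φ hφ)
  | impI d ih =>
    refine .impI (ih s _ (List.forall_mem_cons.2 ⟨?_, ?_⟩))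
    · exact List.mem_cons_self
    · exact fun γ hγ => List.mem_cons_of_mem _ (h γ hγ)
  | impE d e ihd ihe => exact .impE (ihd s Δ h) (ihe s Δ h)
  | raa d ih =>
    refine .raa (ih s _ (List.forall_mem_cons.2 ⟨?_, ?_⟩))
    · exact List.mem_cons_self
    · exact fun γ hγ => List.mem_cons_of_mem _ (h γ hγ)
  | @allI Γ φ a hφ hΓ d ih =>
    obtain ⟨b, hb, hbΔ⟩ := exists_fresh (ProofLength.substAll φ (liftSubst s)).freeVarFinset Δ
    let s' : ℕ ⊕ Fin 0 → L.Term (ℕ ⊕ Fin 0) :=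
      Function.update s (Sum.inl a) (Term.var (Sum.inl b))
    have hs' : ∀ c, c ≠ a → s' (Sum.inl c) = s (Sum.inl c) := fun c hc =>
      Function.update_of_ne (by simpa using hc) _ _
    have hd := ih s' Δ fun γ hγ => by
      rw [substAll_congr γ (s' := s) (fun c hc => hs' c ?_) fun i => i.elim0]
      · exact h γ hγ
      · rintro rfl; exact hΓ γ hγ hc
    have key : ProofLength.substAll (inst φ (Term.var (Sum.inl a))) s' =
        inst (ProofLength.substAll φ (liftSubst s)) (Term.var (Sum.inl b)) := by
      rw [substAll_inst, inst_substAll_liftSubst, inst_substAll_liftSubst]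
      refine substAll_congr φ (fun c hc => hs' c ?_) fun i => ?_
      · rintro rfl; exact hφ hc
      · rw [Subsingleton.elim i (Fin.last 0)]
        simp only [Sum.elim_inr, Fin.snoc_last, Term.subst]
        exact Function.update_self _ _ _
    rw [key] at hd
    exact hd.map (.allI b hb hbΔ)
  | allE t d ih =>
    rw [substAll_inst]
    exact (ih s Δ h).map (.allE _)
  | eqI t => exact ⟨.eqI _⟩
  | eqE φ d e ihd ihe =>
    have h₂ := ihe s Δ h
    rw [substAll_inst] at h₂ ⊢
    exact (ihd s Δ h).elim fun d' => h₂.map (.eqE _ d')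

namespace Derivable

variable {Γ Δ : List (L.Formula ℕ)} {φ ψ : L.Formula ℕ}

theorem weaken (h : Derivable T Γ φ) (hΓ : ∀ γ ∈ Γ, γ ∈ Δ) : Derivable T Δ φ := by
  obtain ⟨d⟩ := h
  have := d.substAll Term.var Δ fun γ hγ => by rw [substAll_var]; exact hΓ γ hγ
  rwa [substAll_var] at this

theorem cut (h : Derivable T Γ φ) (hΓ : ∀ γ ∈ Γ, Derivable T Δ γ) : Derivable T Δ φ := by
  induction Γ generalizing φ with
  | nil => exact h.weaken (by simp)
  | cons γ Γ ih =>
    rw [List.forall_mem_cons] at hΓ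
    exact (ih h.impI hΓ.2).impE hΓ.1

theorem exfalso (h : Derivable T Γ .falsum) : Derivable T Γ φ :=
  .raa (h.weaken fun _ => List.mem_cons_of_mem _)

end Derivable

/-- The hypotheses `Γ` are consistent with the theory `T`. -/
def Consistent (T : L.Theory) (Γ : List (L.Formula ℕ)) : Prop := ¬ Derivable T Γ .falsum

/-- One step of the Henkin construction: a formula is decided and, if it is the negation of a
universal formula that is accepted, a counterexample is named by a new variable. -/
theorem Consistent.exists_step {Γ : List (L.Formula ℕ)} (hΓ : Consistent T Γ) (φ : L.Formula ℕ) :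
    ∃ Δ, Γ ⊆ Δ ∧ Consistent T Δ ∧ (φ ∈ Δ ∨ Derivable T Δ (φ.imp .falsum)) ∧
      ∀ ψ : L.BoundedFormula ℕ 1, φ = ψ.all.imp .falsum → φ ∈ Δ →
        ∃ b, (inst ψ (Term.var (Sum.inl b))).imp .falsum ∈ Δ := by
  by_cases hc : Derivable T (φ :: Γ) .falsum
  · refine ⟨Γ, fun _ => id, hΓ, .inr hc.impI, fun ψ _ hφ => ?_⟩
    exact (hΓ (hc.impI.impE (.hyp hφ))).elim
  by_cases hψ : ∃ ψ : L.BoundedFormula ℕ 1, φ = ψ.all.imp .falsum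
  · obtain ⟨ψ, rfl⟩ := hψ
    obtain ⟨b, hb, hbΓ⟩ := exists_fresh ψ.freeVarFinset (ψ.all.imp .falsum :: Γ)
    refine ⟨(inst ψ (Term.var (Sum.inl b))).imp .falsum :: ψ.all.imp .falsum :: Γ,
      fun γ hγ => by simp [hγ], fun hc' => hc ?_, .inl (by simp), ?_⟩
    · have h₁ : Derivable T (ψ.all.imp .falsum :: Γ) ψ.all := hc'.raa.map (.allI b hb hbΓ)
      exact (Derivable.hyp (by simp)).impE h₁
    · intro ψ' h _
      obtain rfl : ψ = ψ' := by simpa using h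
      exact ⟨b, by simp⟩
  · refine ⟨φ :: Γ, fun γ hγ => by simp [hγ], hc, .inl (by simp), fun ψ h => ?_⟩
    exact (hψ ⟨ψ, h⟩).elim

/-- The properties of the set of formulas that are true in the term model: it is closed under
derivations, consistent and complete, and every failing universal formula has a counterexample
which is a variable. -/
structure IsHenkin (T : L.Theory) (S : Set (L.Formula ℕ)) : Prop where
  closed : ∀ {Γ φ}, Derivable T Γ φ → (∀ γ ∈ Γ, γ ∈ S) → φ ∈ S
  consistent : BoundedFormula.falsum ∉ S
  complete : ∀ φ : L.Formula ℕ, φ ∈ S ∨ φ.imp .falsum ∈ S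
  henkin : ∀ ψ : L.BoundedFormula ℕ 1, ψ.all ∉ S → ∃ b, inst ψ (Term.var (Sum.inl b)) ∉ S

theorem Consistent.exists_isHenkin [Countable (L.Formula ℕ)] {Γ : List (L.Formula ℕ)}
    (hΓ : Consistent T Γ) : ∃ S, IsHenkin T S ∧ ∀ γ ∈ Γ, γ ∈ S := by
  obtain ⟨e, he⟩ := exists_surjective_nat (L.Formula ℕ)
  choose! next hsub hcons hdec hwit using
    fun (Γ : List (L.Formula ℕ)) (φ : L.Formula ℕ) (hΓ : Consistent T Γ) =>
      Consistent.exists_step hΓ φ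
  let G : ℕ → List (L.Formula ℕ) := fun k => Nat.rec Γ (fun k Γ => next Γ (e k)) k
  have hG : ∀ k, Consistent T (G k) := by
    intro k
    induction k with
    | zero => exact hΓ
    | succ k ih => exact hcons _ _ ih
  have hmono : ∀ {k l}, k ≤ l → G k ⊆ G l := by
    intro k l hkl
    induction hkl with
    | refl => exact fun _ => id
    | step _ ih => exact fun γ hγ => hsub _ _ (hG _) (ih hγ)
  let S : Set (L.Formula ℕ) := {φ | ∃ k, Derivable T (G k) φ}
  have closed : ∀ {Γ φ}, Derivable T Γ φ → (∀ γ ∈ Γ, γ ∈ S) → φ ∈ S := by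
    intro Γ φ h hΓ
    have : ∃ k, ∀ γ ∈ Γ, Derivable T (G k) γ := by
      clear h
      induction Γ with
      | nil => exact ⟨0, by simp⟩
      | cons γ Γ ih =>
        rw [List.forall_mem_cons] at hΓ
        obtain ⟨k, hk⟩ := ih hΓ.2
        obtain ⟨l, hl⟩ := hΓ.1
        refine ⟨max k l, List.forall_mem_cons.2 ⟨hl.weaken (hmono (le_max_right _ _)), ?_⟩⟩
        exact fun γ' h' => (hk γ' h').weaken (hmono (le_max_left _ _))
    obtain ⟨k, hk⟩ := this
    exact ⟨k, h.cut hk⟩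
  have consistent : BoundedFormula.falsum ∉ S := fun ⟨k, hk⟩ => hG k hk
  have complete : ∀ φ : L.Formula ℕ, φ ∈ S ∨ φ.imp .falsum ∈ S := by
    intro φ
    obtain ⟨k, rfl⟩ := he φ
    exact (hdec (G k) (e k) (hG k)).imp (fun h => ⟨k + 1, .hyp h⟩) (fun h => ⟨k + 1, h⟩)
  refine ⟨S, ⟨closed, consistent, complete, fun ψ hψ => ?_⟩, fun γ hγ => ⟨0, .hyp hγ⟩⟩
  have hn := (complete ψ.all).resolve_left hψ
  obtain ⟨k, hk⟩ := he (ψ.all.imp .falsum)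
  have contra : ∀ φ : L.Formula ℕ, φ ∈ S → φ.imp .falsum ∉ S := by
    intro φ h h'
    refine consistent (closed (Γ := [φ, φ.imp .falsum]) ?_ (by simp [h, h']))
    exact .impE (φ := φ) (.hyp (by simp)) (.hyp (by simp))
  have hmem : e k ∈ next (G k) (e k) :=
    (hdec (G k) (e k) (hG k)).resolve_right fun h => contra _ (hk ▸ hn) ⟨k + 1, h⟩
  obtain ⟨b, hb⟩ := hwit (G k) (e k) (hG k) ψ hk hmem
  exact ⟨b, fun h => contra _ h ⟨k + 1, .hyp hb⟩⟩

namespace IsHenkin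

variable {S : Set (L.Formula ℕ)} (hS : IsHenkin T S)

include hS

theorem imp_iff {φ ψ : L.Formula ℕ} : φ.imp ψ ∈ S ↔ (φ ∈ S → ψ ∈ S) := by
  constructor
  · intro h h'
    refine hS.closed (Γ := [φ.imp ψ, φ]) (.impE (φ := φ) (.hyp (by simp)) (.hyp (by simp))) ?_
    simp [h, h']
  · intro h
    rcases hS.complete φ with h' | h'
    · exact hS.closed (Γ := [ψ]) (.impI (.hyp (by simp))) (by simpa using h h')
    · refine hS.closed (Γ := [φ.imp .falsum]) (.impI (.exfalso ?_)) (by simpa using h')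
      exact .impE (φ := φ) (.hyp (by simp)) (.hyp (by simp))

theorem all_iff {φ : L.BoundedFormula ℕ 1} : φ.all ∈ S ↔ ∀ t, inst φ t ∈ S := by
  constructor
  · intro h t
    exact hS.closed (Γ := [φ.all]) ((Derivable.hyp (by simp)).map (.allE t)) (by simpa using h)
  · intro h
    by_contra hn
    obtain ⟨b, hb⟩ := hS.henkin φ hn
    exact hb (h _)

theorem eq_subst {s t : L.Term (ℕ ⊕ Fin 0)} (φ : L.BoundedFormula ℕ 1)
    (h : BoundedFormula.equal s t ∈ S) (h' : inst φ s ∈ S) : inst φ t ∈ S := by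
  refine hS.closed (Γ := [.equal s t, inst φ s]) ?_ (by simp [h, h'])
  exact ⟨.eqE φ (.hyp (.equal s t) (by simp)) (.hyp (inst φ s) (by simp))⟩

theorem eq_refl (t : L.Term (ℕ ⊕ Fin 0)) : BoundedFormula.equal t t ∈ S :=
  hS.closed (Γ := []) ⟨.eqI t⟩ (by simp)

/-- Provably equal terms may be exchanged in any context `F` that is built by substitution. -/
theorem congr {k : ℕ} {F : (Fin k → L.Term (ℕ ⊕ Fin 0)) → L.Formula ℕ}
    (hF : ∀ r i, ∃ φ : L.BoundedFormula ℕ 1, ∀ t, inst φ t = F (Function.update r i t))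
    {s t : Fin k → L.Term (ℕ ⊕ Fin 0)} (h : ∀ i, BoundedFormula.equal (s i) (t i) ∈ S)
    (hs : F s ∈ S) : F t ∈ S := by
  suffices ∀ A : Finset (Fin k), F (A.piecewise t s) ∈ S by simpa using this Finset.univ
  intro A
  induction A using Finset.induction with
  | empty => simpa using hs
  | insert i A hi ih =>
    obtain ⟨φ, hφ⟩ := hF (A.piecewise t s) i
    rw [Finset.piecewise_insert, ← hφ]
    refine hS.eq_subst φ (h i) ?_
    rw [hφ]
    convert ih
    simp [hi]

theorem eq_symm {s t : L.Term (ℕ ⊕ Fin 0)} (h : BoundedFormula.equal s t ∈ S) :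
    BoundedFormula.equal t s ∈ S := by
  have key : ∀ r, inst (.equal (.var (.inr 0)) (liftTerm s)) r = BoundedFormula.equal r s :=
    fun r => congrArg (BoundedFormula.equal r) (liftTerm_subst_inst s r)
  rw [← key]
  refine hS.eq_subst _ h ?_
  rw [key]
  exact hS.eq_refl s

theorem eq_trans {r s t : L.Term (ℕ ⊕ Fin 0)} (h : BoundedFormula.equal r s ∈ S)
    (h' : BoundedFormula.equal s t ∈ S) : BoundedFormula.equal r t ∈ S := by
  have key : ∀ q, inst (.equal (liftTerm r) (.var (.inr 0))) q = BoundedFormula.equal r q :=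
    fun q => congrArg (fun p => BoundedFormula.equal p q) (liftTerm_subst_inst r q)
  rw [← key]
  refine hS.eq_subst _ h' ?_
  rw [key]
  exact h

omit hS in
theorem subst_update_liftTerm {k : ℕ} (r : Fin k → L.Term (ℕ ⊕ Fin 0)) (i : Fin k)
    (t : L.Term (ℕ ⊕ Fin 0)) :
    (fun j => (Function.update (fun j => liftTerm (r j)) i (.var (.inr (0 : Fin 1))) j).subst
      (Sum.elim (fun a => Term.var (Sum.inl a)) (fun _ => t))) = Function.update r i t := by
  funext j
  by_cases h : j = i
  · subst h; simp
  · simp [h, liftTerm_subst_inst]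

theorem func_congr {k : ℕ} (f : L.Functions k) {s t : Fin k → L.Term (ℕ ⊕ Fin 0)}
    (h : ∀ i, BoundedFormula.equal (s i) (t i) ∈ S) :
    BoundedFormula.equal (.func f s) (.func f t) ∈ S := by
  refine hS.congr (F := fun r => .equal (.func f s) (.func f r)) (fun r i => ?_) h (hS.eq_refl _)
  refine ⟨.equal (liftTerm (.func f s))
    (.func f (Function.update (fun j => liftTerm (r j)) i (.var (.inr 0)))), fun t => ?_⟩
  rw [inst_eq, substAll, liftTerm_subst_inst, Term.subst, subst_update_liftTerm]

theorem rel_congr {k : ℕ} (R : L.Relations k) {s t : Fin k → L.Term (ℕ ⊕ Fin 0)}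
    (h : ∀ i, BoundedFormula.equal (s i) (t i) ∈ S) (hs : .rel R s ∈ S) : .rel R t ∈ S := by
  refine hS.congr (F := fun r => .rel R r) (fun r i => ?_) h hs
  refine ⟨.rel R (Function.update (fun j => liftTerm (r j)) i (.var (.inr 0))), fun t => ?_⟩
  rw [inst_eq, substAll, subst_update_liftTerm]

/-- Terms are identified if their equality holds. -/
abbrev setoid : Setoid (L.Term (ℕ ⊕ Fin 0)) where
  r s t := BoundedFormula.equal s t ∈ S
  iseqv := ⟨hS.eq_refl, hS.eq_symm, hS.eq_trans⟩

/-- The term model: function and relation symbols are evaluated on representatives. -/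
noncomputable abbrev termModel : L.Structure (Quotient hS.setoid) where
  funMap f xs := Quotient.mk _ (.func f fun i => (xs i).out)
  RelMap R xs := .rel R (fun i => (xs i).out) ∈ S

theorem out_mk (t : L.Term (ℕ ⊕ Fin 0)) :
    BoundedFormula.equal (Quotient.mk hS.setoid t).out t ∈ S :=
  Quotient.mk_out (s := hS.setoid) t

theorem realize_term {X : Type*} (t : L.Term X) (s : X → L.Term (ℕ ⊕ Fin 0)) :
    letI := hS.termModel
    t.realize (fun a => Quotient.mk hS.setoid (s a)) = Quotient.mk hS.setoid (t.subst s) := by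
  induction t with
  | var => rfl
  | func f ts ih =>
    let _ := hS.termModel
    rw [Term.realize_func]
    simp only [ih]
    exact Quotient.sound (hS.func_congr f fun i => hS.out_mk _)

/-- Truth in the term model. -/
theorem realize_iff {α : Type} {n : ℕ} (φ : L.BoundedFormula α n)
    (s : α ⊕ Fin n → L.Term (ℕ ⊕ Fin 0)) :
    letI := hS.termModel
    φ.Realize (fun a => Quotient.mk hS.setoid (s (.inl a)))
      (fun i => Quotient.mk hS.setoid (s (.inr i))) ↔ substAll φ s ∈ S := by
  let _ := hS.termModel
  have key : ∀ {n : ℕ} (s : α ⊕ Fin n → L.Term (ℕ ⊕ Fin 0)),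
      Sum.elim (fun a => Quotient.mk hS.setoid (s (.inl a)))
        (fun i => Quotient.mk hS.setoid (s (.inr i))) = fun a => Quotient.mk hS.setoid (s a) := by
    intro n s
    funext a
    rcases a with a | i <;> rfl
  induction φ with
  | falsum => exact iff_of_false id hS.consistent
  | equal t₁ t₂ =>
    simp only [BoundedFormula.Realize, key, hS.realize_term]
    exact Quotient.eq
  | rel R ts =>
    simp only [BoundedFormula.Realize, key, hS.realize_term]
    exact ⟨hS.rel_congr R fun i => hS.out_mk _,
      hS.rel_congr R fun i => hS.eq_symm (hS.out_mk _)⟩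
  | imp φ ψ ih₁ ih₂ =>
    rw [BoundedFormula.realize_imp, substAll, hS.imp_iff]
    exact imp_congr (ih₁ s) (ih₂ s)
  | all φ ih =>
    rw [BoundedFormula.realize_all, substAll, hS.all_iff, Quotient.forall]
    refine forall_congr' fun t => ?_
    rw [inst_substAll_liftSubst]
    refine Iff.trans (iff_of_eq (congrArg _ ?_)) (ih (Sum.elim (fun a => s (.inl a))
      (Fin.snoc (fun i => s (.inr i)) t : Fin (_ + 1) → L.Term (ℕ ⊕ Fin 0))))
    funext i
    induction i using Fin.lastCases with
    | last => simp
    | cast i => simp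

end IsHenkin

/-- Gödel's completeness theorem for countable languages. -/
theorem completeness [Countable (L.Formula ℕ)] {σ : L.Sentence}
    (h : ∀ (M : Type u) [L.Structure M] [Nonempty M], M ⊨ T → M ⊨ σ) : Provable T σ := by
  by_contra hσ
  have hcons : Consistent T [(ofSentence σ).imp .falsum] := fun h' => hσ h'.raa
  obtain ⟨S, hS, hmem⟩ := hcons.exists_isHenkin
  let _ := hS.termModel
  have hreal : ∀ τ : L.Sentence, ofSentence τ ∈ S ↔ Quotient hS.setoid ⊨ τ := by
    intro τ
    rw [← realize_ofSentence τ (fun a => Quotient.mk hS.setoid (.var (.inl a))) Fin.elim0,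
      ← substAll_var (ofSentence τ), ← hS.realize_iff, substAll_var]
    exact iff_of_eq (congrArg _ (Subsingleton.elim _ _))
  have : Nonempty (Quotient hS.setoid) := ⟨Quotient.mk hS.setoid (.var (.inl 0))⟩
  have hT : Quotient hS.setoid ⊨ T := (Theory.model_iff T).2 fun τ hτ =>
    (hreal τ).1 (hS.closed (Γ := []) ⟨.ax τ hτ⟩ (by simp))
  exact hS.consistent ((hS.imp_iff.1 (hmem _ (by simp))) ((hreal σ).2 (h _ hT)))

end Completeness

/-! ### Number of symbols and quantifier depth -/

section Measures

variable {L : FirstOrder.Language.{u, v}} {α β : Type}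

/-- The number of symbols of a term, where a variable counts as one symbol. -/
def termNodes {α : Type*} : L.Term α → ℕ
  | .var _ => 1
  | .func _ ts => 1 + ∑ i, termNodes (ts i)

/-- The number of symbols of a formula, where a variable counts as one symbol. -/
def nodes : {n : ℕ} → L.BoundedFormula α n → ℕ
  | _, .falsum => 1
  | _, .equal t₁ t₂ => 1 + termNodes t₁ + termNodes t₂
  | _, .rel _ ts => 1 + ∑ i, termNodes (ts i)
  | _, .imp φ ψ => 1 + nodes φ + nodes ψ
  | _, .all φ => 1 + nodes φ

/-- The number of nested quantifiers of a formula. -/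
def quantDepth : {n : ℕ} → L.BoundedFormula α n → ℕ
  | _, .falsum => 0
  | _, .equal _ _ => 0
  | _, .rel _ _ => 0
  | _, .imp φ ψ => max (quantDepth φ) (quantDepth ψ)
  | _, .all φ => quantDepth φ + 1

theorem one_le_nodes {n : ℕ} (φ : L.BoundedFormula α n) : 1 ≤ nodes φ := by
  cases φ <;> simp only [nodes] <;> omega

theorem one_le_termNodes (t : L.Term α) : 1 ≤ termNodes t := by
  cases t <;> simp only [termNodes] <;> omega

theorem termNodes_relabel (t : L.Term α) (g : α → β) : termNodes (t.relabel g) = termNodes t := by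
  induction t with
  | var => rfl
  | func f ts ih => simp [termNodes, ih]

theorem termSize_liftTerm {n : ℕ} (t : L.Term (ℕ ⊕ Fin n)) :
    termSize (liftTerm t) = termSize t := by
  unfold liftTerm
  induction t with
  | var a => rcases a with a | i <;> simp [termSize]
  | func f ts ih => simp [termSize, ih]

theorem termNodes_le_termSize {n : ℕ} (t : L.Term (ℕ ⊕ Fin n)) : termNodes t ≤ termSize t := by
  induction t with
  | var a => rcases a with a | i <;> simp [termNodes, termSize, varSize]
  | func f ts ih => exact Nat.add_le_add_left (Finset.sum_le_sum fun i _ => ih i) 1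

theorem nodes_le_formulaSize {n : ℕ} (φ : L.BoundedFormula ℕ n) : nodes φ ≤ formulaSize φ := by
  induction φ with
  | falsum => exact le_rfl
  | equal t₁ t₂ =>
    have := termNodes_le_termSize t₁
    have := termNodes_le_termSize t₂
    simp only [nodes, formulaSize]
    omega
  | rel R ts =>
    exact Nat.add_le_add_left (Finset.sum_le_sum fun i _ => termNodes_le_termSize _) 1
  | imp φ ψ ih₁ ih₂ => simp only [nodes, formulaSize]; omega
  | all φ ih => simp only [nodes, formulaSize]; omega

theorem termNodes_le_subst {α β : Type*} (t : L.Term α) (s : α → L.Term β)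
    (hs : ∀ a, 1 ≤ termNodes (s a)) : termNodes t ≤ termNodes (t.subst s) := by
  induction t with
  | var a => exact hs a
  | func f ts ih => exact Nat.add_le_add_left (Finset.sum_le_sum fun i _ => ih i) 1

theorem nodes_le_substAll {m : ℕ} (φ : L.BoundedFormula α m) : ∀ {n : ℕ}
    (s : α ⊕ Fin m → L.Term (β ⊕ Fin n)), nodes φ ≤ nodes (substAll φ s) := by
  induction φ with
  | falsum => exact fun _ => le_rfl
  | equal t₁ t₂ =>
    intro n s
    have := termNodes_le_subst t₁ s fun _ => one_le_termNodes _
    have := termNodes_le_subst t₂ s fun _ => one_le_termNodes _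
    simp only [nodes, substAll]
    omega
  | rel R ts =>
    intro n s
    exact Nat.add_le_add_left (Finset.sum_le_sum fun i _ =>
      termNodes_le_subst _ s fun _ => one_le_termNodes _) 1
  | imp φ ψ ih₁ ih₂ =>
    intro n s
    have := ih₁ s
    have := ih₂ s
    simp only [nodes, substAll]
    omega
  | all φ ih => exact fun s => Nat.add_le_add_left (ih _) 1

theorem termNodes_subst {α β : Type*} (t : L.Term α) (s : α → L.Term β)
    (hs : ∀ a, termNodes (s a) = 1) : termNodes (t.subst s) = termNodes t := by
  induction t with
  | var a => exact hs a
  | func f ts ih => simp [termNodes, ih]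

theorem nodes_substAll {m : ℕ} (φ : L.BoundedFormula α m) : ∀ {n : ℕ}
    (s : α ⊕ Fin m → L.Term (β ⊕ Fin n)) (_ : ∀ a, termNodes (s a) = 1),
    nodes (substAll φ s) = nodes φ := by
  induction φ with
  | falsum => exact fun _ _ => rfl
  | equal t₁ t₂ => intro n s hs; simp [nodes, substAll, termNodes_subst _ s hs]
  | rel R ts => intro n s hs; simp [nodes, substAll, termNodes_subst _ s hs]
  | imp φ ψ ih₁ ih₂ => intro n s hs; simp [nodes, substAll, ih₁ s hs, ih₂ s hs]
  | all φ ih =>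
    intro n s hs
    refine congrArg (1 + ·) (ih _ fun a => ?_)
    rcases a with a | i
    · rw [liftSubst_inl, liftTerm, termNodes_relabel, hs]
    · induction i using Fin.lastCases with
      | last => rw [liftSubst_last]; rfl
      | cast i => rw [liftSubst_castSucc, liftTerm, termNodes_relabel, hs]

theorem quantDepth_substAll {m : ℕ} (φ : L.BoundedFormula α m) : ∀ {n : ℕ}
    (s : α ⊕ Fin m → L.Term (β ⊕ Fin n)), quantDepth (substAll φ s) = quantDepth φ := by
  induction φ with
  | falsum => exact fun _ => rfl
  | equal t₁ t₂ => exact fun _ => rfl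
  | rel R ts => exact fun _ => rfl
  | imp φ ψ ih₁ ih₂ => intro n s; simp [quantDepth, substAll, ih₁, ih₂]
  | all φ ih => intro n s; simp [quantDepth, substAll, ih]

theorem varSize_le (i : ℕ) : varSize i ≤ 1 + i :=
  Nat.add_le_add_left (Nat.size_le.2 i.lt_two_pow_self) 1

theorem termSize_subst_le {X : Type*} {n B : ℕ} (t : L.Term X) (s : X → L.Term (ℕ ⊕ Fin n))
    (hs : ∀ a, termSize (s a) ≤ B) : termSize (t.subst s) ≤ termNodes t * (B + 2) := by
  induction t with
  | var a => have := hs a; simp only [Term.subst, termNodes]; omega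
  | func f ts ih =>
    simp only [Term.subst, termNodes, termSize, add_mul, Finset.sum_mul]
    exact Nat.add_le_add (by omega) (Finset.sum_le_sum fun i _ => ih i)

/-- A substitution instance is about as long as the number of symbols times the greatest length
of the substituted terms and of the bound variables. -/
theorem formulaSize_substAll_le {B m : ℕ} (φ : L.BoundedFormula α m) : ∀ {n : ℕ}
    (s : α ⊕ Fin m → L.Term (ℕ ⊕ Fin n)) (_ : ∀ a, termSize (s a) ≤ B)
    (_ : n + quantDepth φ ≤ B), formulaSize (substAll φ s) ≤ nodes φ * (B + 2) := by
  induction φ with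
  | falsum => intro n s hs hB; simp only [substAll, formulaSize, nodes]; omega
  | equal t₁ t₂ =>
    intro n s hs hB
    have := termSize_subst_le t₁ s hs
    have := termSize_subst_le t₂ s hs
    simp only [substAll, formulaSize, nodes, add_mul]
    omega
  | rel R ts =>
    intro n s hs hB
    simp only [substAll, formulaSize, nodes, add_mul, Finset.sum_mul]
    exact Nat.add_le_add (by omega) (Finset.sum_le_sum fun i _ => termSize_subst_le _ s hs)
  | imp φ ψ ih₁ ih₂ =>
    intro n s hs hB
    simp only [quantDepth] at hB
    have := ih₁ s hs (by omega)
    have := ih₂ s hs (by omega)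
    simp only [substAll, formulaSize, nodes, add_mul]
    omega
  | all φ ih =>
    intro n s hs hB
    simp only [quantDepth] at hB
    have := varSize_le n
    have := ih (liftSubst s) (fun a => ?_) (by omega)
    · simp only [substAll, formulaSize, nodes, add_mul]
      omega
    · rcases a with a | i
      · rw [liftSubst_inl, termSize_liftTerm]; exact hs _
      · induction i using Fin.lastCases with
        | last => simp only [liftSubst_last, termSize, Fin.val_last]; omega
        | cast i => rw [liftSubst_castSucc, termSize_liftTerm]; exact hs _

theorem nodes_le_sentenceSize (σ : L.Sentence) : nodes σ ≤ sentenceSize σ :=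
  (nodes_le_substAll σ _).trans (nodes_le_formulaSize _)

theorem Derivation.formulaSize_le_size {T : L.Theory} {Γ : List (L.Formula ℕ)} {φ : L.Formula ℕ}
    (d : Derivation T Γ φ) : formulaSize φ ≤ d.size := by
  cases d <;> simp only [Derivation.size, sequentSize] <;> omega

theorem Derivation.sentenceSize_le_size {T : L.Theory} {Γ : List (L.Formula ℕ)} {φ : L.Formula ℕ}
    (d : Derivation T Γ φ) {σ : L.Sentence} (hσ : σ ∈ d.used) : sentenceSize σ ≤ d.size := by
  induction d with
  | ax τ h =>
    obtain rfl : σ = τ := hσ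
    simp only [Derivation.size, sequentSize, sentenceSize]
    omega
  | hyp φ h => exact hσ.elim
  | eqI t => exact hσ.elim
  | impI d ih => have := ih hσ; simp only [Derivation.size]; omega
  | raa d ih => have := ih hσ; simp only [Derivation.size]; omega
  | allI a _ _ d ih => have := ih hσ; simp only [Derivation.size]; omega
  | allE t d ih => have := ih hσ; simp only [Derivation.size]; omega
  | impE d e ihd ihe =>
    simp only [Derivation.size]
    rcases hσ with h | h
    · have := ihd h; omega
    · have := ihe h; omega
  | eqE φ d e ihd ihe =>
    simp only [Derivation.size]
    rcases hσ with h | h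
    · have := ihd h; omega
    · have := ihe h; omega

end Measures

/-! ### Interpretation of a relation symbol by a formula -/

section Interpretation

/-- The relation symbols of the language with a single relation symbol, of arity `k`. -/
inductive OneRel (k : ℕ) : ℕ → Type
  | sym : OneRel k k

/-- The language `L` together with a new `k`-ary relation symbol. -/
abbrev withRel (L : FirstOrder.Language.{0, 0}) (k : ℕ) : FirstOrder.Language.{0, 0} :=
  L.sum ⟨fun _ => Empty, OneRel k⟩

variable {L : FirstOrder.Language.{0, 0}} {k : ℕ} {α β : Type}

/-- A term of the extended language, as a term of the original language. -/
def reductTerm {α : Type*} : (withRel L k).Term α → L.Term α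
  | .var a => .var a
  | .func (.inl f) ts => .func f fun i => reductTerm (ts i)
  | .func (.inr f) _ => Empty.elim f

/-- Replace the new relation symbol by the formula `I`. -/
def interpret (I : L.BoundedFormula Empty k) :
    {n : ℕ} → (withRel L k).BoundedFormula α n → L.BoundedFormula α n
  | _, .falsum => .falsum
  | _, .equal t₁ t₂ => .equal (reductTerm t₁) (reductTerm t₂)
  | _, .rel (.inl R) ts => .rel R fun i => reductTerm (ts i)
  | _, .rel (.inr .sym) ts => substAll I (Sum.elim Empty.elim fun i => reductTerm (ts i))
  | _, .imp φ ψ => .imp (interpret I φ) (interpret I ψ)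
  | _, .all φ => .all (interpret I φ)

theorem reductTerm_subst {α β : Type*} (t : (withRel L k).Term α)
    (s : α → (withRel L k).Term β) :
    reductTerm (t.subst s) = (reductTerm t).subst fun a => reductTerm (s a) := by
  induction t with
  | var a => rfl
  | func f ts ih =>
    rcases f with f | f
    · simp [reductTerm, ih]
    · exact f.elim

theorem reductTerm_relabel {α β : Type*} (t : (withRel L k).Term α) (g : α → β) :
    reductTerm (t.relabel g) = (reductTerm t).relabel g := by
  induction t with
  | var a => rfl
  | func f ts ih =>
    rcases f with f | f
    · simp [reductTerm, ih]
    · exact f.elim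

theorem reductTerm_liftSubst {m n : ℕ} (s : α ⊕ Fin m → (withRel L k).Term (β ⊕ Fin n)) :
    (fun a => reductTerm (liftSubst s a)) = liftSubst fun a => reductTerm (s a) := by
  apply substitution_ext <;> simp [liftTerm, reductTerm_relabel, reductTerm]

variable (I : L.BoundedFormula Empty k)

theorem interpret_substAll {m : ℕ} (φ : (withRel L k).BoundedFormula α m) : ∀ {n : ℕ}
    (s : α ⊕ Fin m → (withRel L k).Term (β ⊕ Fin n)),
    interpret I (substAll φ s) = substAll (interpret I φ) fun a => reductTerm (s a) := by
  induction φ with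
  | falsum => exact fun _ => rfl
  | equal t₁ t₂ => intro n s; simp only [substAll, interpret, reductTerm_subst]
  | rel R ts =>
    intro n s
    rcases R with R | R
    · simp only [substAll, interpret, reductTerm_subst]
    · cases R
      simp only [substAll, interpret, substAll_substAll, reductTerm_subst]
      congr 1
      funext a
      rcases a with a | i
      · exact a.elim
      · rfl
  | imp φ ψ ih₁ ih₂ => intro n s; simp only [substAll, interpret, ih₁, ih₂]
  | all φ ih => intro n s; simp only [substAll, interpret, ih, reductTerm_liftSubst]

theorem interpret_inst (φ : (withRel L k).BoundedFormula ℕ 1)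
    (t : (withRel L k).Term (ℕ ⊕ Fin 0)) :
    interpret I (inst φ t) = inst (interpret I φ) (reductTerm t) := by
  rw [inst_eq, interpret_substAll, inst_eq]
  congr 1
  funext a
  rcases a with a | i <;> rfl

theorem interpret_ofSentence (σ : (withRel L k).Sentence) :
    interpret I (ofSentence σ) = ofSentence (interpret I σ) := by
  rw [ofSentence, interpret_substAll, ofSentence]
  congr 1
  funext a
  rcases a with a | i
  · exact a.elim
  · exact i.elim0

theorem interpret_app {m n : ℕ} (φ : (withRel L k).BoundedFormula Empty m)
    (t : Fin m → (withRel L k).Term (Empty ⊕ Fin n)) :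
    interpret I (app φ t) = app (interpret I φ) fun i => reductTerm (t i) := by
  rw [app, interpret_substAll, app]
  congr 1
  funext a
  rcases a with a | i
  · exact a.elim
  · rfl

theorem varFinsetLeft_reductTerm [DecidableEq α] {X : Type*} (t : (withRel L k).Term (α ⊕ X)) :
    (reductTerm t).varFinsetLeft = t.varFinsetLeft := by
  induction t with
  | var a => rcases a with a | a <;> rfl
  | func f ts ih =>
    rcases f with f | f
    · simp [reductTerm, ih]
    · exact f.elim

theorem freeVarFinset_interpret_subset [DecidableEq α] {n : ℕ}
    (φ : (withRel L k).BoundedFormula α n) :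
    (interpret I φ).freeVarFinset ⊆ φ.freeVarFinset := by
  induction φ with
  | falsum => exact fun _ => id
  | equal t₁ t₂ => simp [interpret, varFinsetLeft_reductTerm]
  | rel R ts =>
    rcases R with R | R
    · simp [interpret, varFinsetLeft_reductTerm]
    · cases R
      intro a ha
      obtain ⟨b, hb⟩ := mem_freeVarFinset_substAll I _ ha
      rcases b with b | i
      · exact b.elim
      · simp only [Sum.elim_inr, varFinsetLeft_reductTerm] at hb
        simpa using ⟨i, hb⟩
  | imp φ ψ ih₁ ih₂ => exact Finset.union_subset_union ih₁ ih₂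
  | all φ ih => exact ih

/-- With `φ` fixed, the size of the interpreted formula depends on `I` only through its number of
symbols and its quantifier depth, the latter because it bounds the indices of bound variables. -/
theorem exists_formulaSize_interpret_le {n : ℕ} (φ : (withRel L k).BoundedFormula ℕ n) :
    ∃ C, ∀ I : L.BoundedFormula Empty k,
      formulaSize (interpret I φ) ≤ C * (nodes I * (quantDepth I + 1)) := by
  have hpos : ∀ I : L.BoundedFormula Empty k, 1 ≤ nodes I * (quantDepth I + 1) := fun I =>
    Nat.mul_pos (one_le_nodes I) (Nat.succ_pos _)
  have hconst : ∀ (c : ℕ) (I : L.BoundedFormula Empty k),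
      c ≤ c * (nodes I * (quantDepth I + 1)) := fun c I => Nat.le_mul_of_pos_right c (hpos I)
  induction φ with
  | falsum => exact ⟨1, hconst 1⟩
  | equal t₁ t₂ => exact ⟨_, hconst _⟩
  | rel R ts =>
    rcases R with R | R
    · exact ⟨_, hconst _⟩
    · cases R
      rename_i n
      refine ⟨∑ i, termSize (reductTerm (ts i)) + n + 2, fun I => ?_⟩
      have h := formulaSize_substAll_le (B := ∑ i, termSize (reductTerm (ts i)) + n + quantDepth I)
        I (Sum.elim Empty.elim fun i => reductTerm (ts i)) (fun a => ?_) (by omega)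
      · refine h.trans ?_
        rw [mul_left_comm]
        refine Nat.mul_le_mul_left _ ?_
        nlinarith [Nat.zero_le (∑ i, termSize (reductTerm (ts i)) + n)]
      · rcases a with a | i
        · exact a.elim
        · have := Finset.single_le_sum (f := fun i => termSize (reductTerm (ts i)))
            (fun _ _ => Nat.zero_le _) (Finset.mem_univ i)
          simp only [Sum.elim_inr]
          omega
  | imp φ ψ ih₁ ih₂ =>
    obtain ⟨C₁, h₁⟩ := ih₁
    obtain ⟨C₂, h₂⟩ := ih₂
    refine ⟨1 + C₁ + C₂, fun I => ?_⟩
    have := h₁ I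
    have := h₂ I
    have := hpos I
    simp only [interpret, formulaSize, add_mul]
    omega
  | all φ ih =>
    rename_i n
    obtain ⟨C, h⟩ := ih
    refine ⟨1 + varSize n + C, fun I => ?_⟩
    have := h I
    have := hconst (1 + varSize n) I
    simp only [interpret, formulaSize, add_mul] at this ⊢
    omega

theorem exists_sequentSize_interpret_le (Γ : List ((withRel L k).Formula ℕ))
    (φ : (withRel L k).Formula ℕ) :
    ∃ C, ∀ I : L.BoundedFormula Empty k,
      sequentSize (Γ.map (interpret I)) (interpret I φ) ≤
        C * (nodes I * (quantDepth I + 1)) := by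
  induction Γ with
  | nil =>
    obtain ⟨C, h⟩ := exists_formulaSize_interpret_le φ
    exact ⟨C, fun I => by simpa [sequentSize] using h I⟩
  | cons γ Γ ih =>
    obtain ⟨C₁, h₁⟩ := exists_formulaSize_interpret_le γ
    obtain ⟨C₂, h₂⟩ := ih
    refine ⟨C₁ + 1 + C₂, fun I => ?_⟩
    have := h₁ I
    have := h₂ I
    have : 1 ≤ nodes I * (quantDepth I + 1) :=
      Nat.mul_pos (one_le_nodes I) (Nat.succ_pos _)
    simp only [sequentSize, List.map_cons, List.sum_cons, add_mul] at *
    omega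

/-- A derivation in the extended language is a schema: each formula `I` in the place of the new
relation symbol gives a derivation whose size is linear in the number of symbols and in the
quantifier depth of `I`. -/
theorem Derivation.exists_interpret {T' : (withRel L k).Theory} {T : L.Theory}
    {Γ : List ((withRel L k).Formula ℕ)} {φ : (withRel L k).Formula ℕ} (d : Derivation T' Γ φ) :
    ∃ C, ∀ I : L.BoundedFormula Empty k, (∀ σ ∈ T', interpret I σ ∈ T) →
      ∃ d' : Derivation T (Γ.map (interpret I)) (interpret I φ),
        d'.size ≤ C * (nodes I * (quantDepth I + 1)) := by
  induction d with
  | @ax Γ σ h =>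
    obtain ⟨C, hC⟩ := exists_sequentSize_interpret_le Γ (ofSentence σ)
    refine ⟨C, fun I hI => ?_⟩
    have := hC I
    rw [interpret_ofSentence] at this ⊢
    exact ⟨.ax _ (hI σ h), this⟩
  | @hyp Γ φ h =>
    obtain ⟨C, hC⟩ := exists_sequentSize_interpret_le Γ φ
    exact ⟨C, fun I hI => ⟨.hyp _ (List.mem_map_of_mem h), hC I⟩⟩
  | @impI Γ φ ψ d ih =>
    obtain ⟨C, hC⟩ := exists_sequentSize_interpret_le Γ (φ.imp ψ)
    obtain ⟨C', hC'⟩ := ih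
    refine ⟨C + C', fun I hI => ?_⟩
    obtain ⟨d', hd'⟩ := hC' I hI
    exact ⟨.impI d', by rw [add_mul]; exact Nat.add_le_add (hC I) hd'⟩
  | @impE Γ φ ψ d e ihd ihe =>
    obtain ⟨C, hC⟩ := exists_sequentSize_interpret_le Γ ψ
    obtain ⟨C₁, hC₁⟩ := ihd
    obtain ⟨C₂, hC₂⟩ := ihe
    refine ⟨C + C₁ + C₂, fun I hI => ?_⟩
    obtain ⟨d', hd'⟩ := hC₁ I hI
    obtain ⟨e', he'⟩ := hC₂ I hI
    exact ⟨.impE d' e', by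
      rw [add_mul, add_mul]; exact Nat.add_le_add (Nat.add_le_add (hC I) hd') he'⟩
  | @raa Γ φ d ih =>
    obtain ⟨C, hC⟩ := exists_sequentSize_interpret_le Γ φ
    obtain ⟨C', hC'⟩ := ih
    refine ⟨C + C', fun I hI => ?_⟩
    obtain ⟨d', hd'⟩ := hC' I hI
    exact ⟨.raa d', by rw [add_mul]; exact Nat.add_le_add (hC I) hd'⟩
  | @allI Γ φ a hφ hΓ d ih =>
    obtain ⟨C, hC⟩ := exists_sequentSize_interpret_le Γ φ.all
    obtain ⟨C', hC'⟩ := ih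
    refine ⟨C + C', fun I hI => ?_⟩
    obtain ⟨d', hd'⟩ := hC' I hI
    revert d'
    rw [interpret_inst]
    intro d' hd'
    have hΓ' : ∀ γ ∈ Γ.map (interpret I), a ∉ BoundedFormula.freeVarFinset γ :=
      List.forall_mem_map.2 fun γ hγ h => hΓ γ hγ (freeVarFinset_interpret_subset I γ h)
    exact ⟨.allI a (fun h => hφ (freeVarFinset_interpret_subset I φ h)) hΓ' d',
      by rw [add_mul]; exact Nat.add_le_add (hC I) hd'⟩
  | @allE Γ φ t d ih =>
    obtain ⟨C, hC⟩ := exists_sequentSize_interpret_le Γ (inst φ t)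
    obtain ⟨C', hC'⟩ := ih
    refine ⟨C + C', fun I hI => ?_⟩
    obtain ⟨d', hd'⟩ := hC' I hI
    have := hC I
    rw [interpret_inst] at this ⊢
    exact ⟨.allE _ d', by rw [add_mul]; exact Nat.add_le_add this hd'⟩
  | @eqI Γ t =>
    obtain ⟨C, hC⟩ := exists_sequentSize_interpret_le Γ (.equal t t)
    exact ⟨C, fun I hI => ⟨.eqI _, hC I⟩⟩
  | @eqE Γ φ s t d e ihd ihe =>
    obtain ⟨C, hC⟩ := exists_sequentSize_interpret_le Γ (inst φ t)
    obtain ⟨C₁, hC₁⟩ := ihd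
    obtain ⟨C₂, hC₂⟩ := ihe
    refine ⟨C + C₁ + C₂, fun I hI => ?_⟩
    obtain ⟨d', hd'⟩ := hC₁ I hI
    obtain ⟨e', he'⟩ := hC₂ I hI
    have := hC I
    revert e'
    rw [interpret_inst] at this ⊢
    rw [interpret_inst]
    intro e' he'
    exact ⟨.eqE _ d' e', by
      rw [add_mul, add_mul]; exact Nat.add_le_add (Nat.add_le_add this hd') he'⟩

end Interpretation

/-! ### Models of `PrA⁻` -/

section Realize

variable {M : Type*} [Zero M] [One M] [Add M]

@[simp] theorem realize_x {n : ℕ} (i : Fin n) (v : Empty → M) (xs : Fin n → M) :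
    (x i : presburger.Term (Empty ⊕ Fin n)).realize (Sum.elim v xs) = xs i := rfl

@[simp] theorem realize_le {n : ℕ} (s t : presburger.Term (Empty ⊕ Fin n)) (v : Empty → M)
    (xs : Fin n → M) : (le s t).Realize v xs ↔
      ∃ c, s.realize (Sum.elim v xs) + c = t.realize (Sum.elim v xs) := by
  simp [le]

@[simp] theorem realize_lt {n : ℕ} (s t : presburger.Term (Empty ⊕ Fin n)) (v : Empty → M)
    (xs : Fin n → M) : (lt s t).Realize v xs ↔
      (∃ c, s.realize (Sum.elim v xs) + c = t.realize (Sum.elim v xs)) ∧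
        s.realize (Sum.elim v xs) ≠ t.realize (Sum.elim v xs) := by
  simp [lt]

@[simp] theorem realize_app₃ {n : ℕ} (I : presburger.BoundedFormula Empty 3)
    (r s t : presburger.Term (Empty ⊕ Fin n)) (v : Empty → M) (xs : Fin n → M) :
    (app₃ I r s t).Realize v xs ↔ I.Realize v ![r.realize (Sum.elim v xs),
      s.realize (Sum.elim v xs), t.realize (Sum.elim v xs)] := by
  rw [app₃, realize_app]
  refine iff_of_eq (congrArg _ ?_)
  funext i
  fin_cases i <;> rfl

theorem realize_mulZero (v : Empty → M) (a b c : M) :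
    mulZero.Realize v ![a, b, c] ↔ (b = 0 → c = 0) ∧ (b = 1 → c = a) ∧ (b = 1 + 1 → c = a + a) ∧
      (b = 0 ∨ b = 1 ∨ b = 1 + 1) := by
  simp [mulZero, numeral, mulNat, or_iff_not_imp_left]

theorem realize_mulStep (I : presburger.BoundedFormula Empty 3) (v : Empty → M) (a b c : M) :
    (mulStep I).Realize v ![a, b, c] ↔ ∃ y₁ y₂ y₃ y₄ z₁ z₂ z₄ : M, b = y₃ + y₄ ∧
      (I.Realize v ![y₁, y₂, y₃] ∧ I.Realize v ![a, y₁, z₁] ∧ I.Realize v ![z₁, y₂, z₂] ∧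
        I.Realize v ![a, y₄, z₄]) ∧ c = z₂ + z₄ ∧ (∃ e, y₂ + e = y₁) ∧ y₂ ≠ y₁ := by
  have key : ∀ y₁ y₂ y₃ y₄ z₁ z₂ z₄ : M,
      (∀ p q r : M, p = y₁ ∧ q = y₂ ∧ r = y₃ ∨ p = a ∧ q = y₁ ∧ r = z₁ ∨
        p = z₁ ∧ q = y₂ ∧ r = z₂ ∨ p = a ∧ q = y₄ ∧ r = z₄ → I.Realize v ![p, q, r]) ↔
      (I.Realize v ![y₁, y₂, y₃] ∧ I.Realize v ![a, y₁, z₁] ∧ I.Realize v ![z₁, y₂, z₂] ∧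
        I.Realize v ![a, y₄, z₄]) := by
    intro y₁ y₂ y₃ y₄ z₁ z₂ z₄
    constructor
    · intro h
      exact ⟨h _ _ _ (.inl ⟨rfl, rfl, rfl⟩), h _ _ _ (.inr (.inl ⟨rfl, rfl, rfl⟩)),
        h _ _ _ (.inr (.inr (.inl ⟨rfl, rfl, rfl⟩))),
        h _ _ _ (.inr (.inr (.inr ⟨rfl, rfl, rfl⟩)))⟩
    · rintro ⟨h₁, h₂, h₃, h₄⟩ p q r (⟨rfl, rfl, rfl⟩ | ⟨rfl, rfl, rfl⟩ | ⟨rfl, rfl, rfl⟩ |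
        ⟨rfl, rfl, rfl⟩) <;> assumption
  simp only [← key]
  simp [mulStep, -exists_and_left, -exists_and_right, -and_imp, -exists_exists_eq_and]

/-- `Hyp(b)`, for an arbitrary relation in the place of `Mul`. -/
def HypHolds (R : M → M → M → Prop) (b : M) : Prop :=
  R 1 b b ∧ R 0 b 0 ∧ (∀ a, ∃ c, R a b c ∧ ∀ d, R a b d → d = c) ∧
    ∀ a₁ a₂, ∃ c₁ c₂, R a₁ b c₁ ∧ R a₂ b c₂ ∧ R (a₁ + a₂) b (c₁ + c₂)

/-- `Div(a)`, for an arbitrary relation in the place of `Mul`. -/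
def DivHolds (R : M → M → M → Prop) (a : M) : Prop :=
  ∀ b, HypHolds R b →
    b = 0 ∨ ∃ q c r, R q b c ∧ a = c + r ∧ (∃ e, r + e = b) ∧ r ≠ b

theorem realize_hyp (n : ℕ) (v : Empty → M) (xs : Fin 1 → M) :
    (hyp n).Realize v xs ↔ HypHolds (fun a b c => (mul n).Realize v ![a, b, c]) (xs 0) := by
  simp [hyp, HypHolds, Fin.snoc]
  intro _ _ _
  constructor
  · intro h a₁ a₂
    obtain ⟨c₁, c₂, ⟨h₁, h₂⟩, h₃⟩ := h (a₁ + a₂) a₁ a₂ rfl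
    exact ⟨c₁, h₁, c₂, h₂, h₃⟩
  · rintro h a a₁ a₂ rfl
    obtain ⟨c₁, h₁, c₂, h₂, h₃⟩ := h a₁ a₂
    exact ⟨c₁, c₂, ⟨h₁, h₂⟩, h₃⟩

theorem realize_div (n : ℕ) (v : Empty → M) (xs : Fin 1 → M) :
    (div n).Realize v xs ↔ DivHolds (fun a b c => (mul n).Realize v ![a, b, c]) (xs 0) := by
  have happ : ∀ b, (app₁ (hyp n) (x 1)).Realize v (Fin.snoc xs b : Fin 2 → M) ↔
      HypHolds (fun a b c => (mul n).Realize v ![a, b, c]) b := by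
    intro b
    rw [app₁, realize_app, realize_hyp]
    rfl
  simp [div, DivHolds, Fin.snoc, happ]

theorem realize_divSentence (n : ℕ) : M ⊨ divSentence n ↔
    ∀ a, DivHolds (fun a b c : M => (mul n).Realize default ![a, b, c]) a := by
  rw [divSentence, Sentence.Realize, Formula.Realize, BoundedFormula.realize_all]
  exact forall_congr' fun a => realize_div n _ _

end Realize

theorem realize_mulNat {α : Type} {M : Type*} [AddMonoid M] [One M] (t : presburger.Term α)
    (v : α → M) : ∀ n, (mulNat t n).realize v = n • t.realize v
  | 0 => by simp [mulNat]
  | 1 => by simp [mulNat]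
  | n + 2 => by
    rw [mulNat, presburger.realize_add, realize_mulNat t v (n + 1), succ_nsmul' _ (n + 1)]

theorem realize_disj {M : Type*} [presburger.Structure M] {n : ℕ}
    (φ : ℕ → presburger.BoundedFormula Empty n) (v : Empty → M) (xs : Fin n → M) (k : ℕ) :
    (disj φ k).Realize v xs ↔ ∃ i ≤ k, (φ i).Realize v xs := by
  induction k with
  | zero => simp [disj]
  | succ k ih => simp [disj, ih, Nat.le_succ_iff, or_and_right, exists_or]

/-- The cancellative commutative monoids that are models of `PrA⁻`. -/
structure IsMinusModel (M : Type*) [AddCancelCommMonoid M] [One M] : Prop where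
  add_one_ne_zero : ∀ a : M, a + 1 ≠ 0
  exists_eq_add_one : ∀ a : M, a ≠ 0 → ∃ b, a = b + 1
  total : ∀ a b : M, (∃ c, a + c = b) ∨ ∃ c, b + c = a

theorem IsMinusModel.model {M : Type*} [AddCancelCommMonoid M] [One M] (h : IsMinusModel M) :
    M ⊨ PrAMinus := by
  have h₁ := h.add_one_ne_zero
  have h₂ := h.exists_eq_add_one
  have h₃ := h.total
  simp [PrAMinus, Sentence.Realize, Formula.Realize, Fin.snoc]
  exact ⟨add_assoc, add_comm, h₁, h₂, h₃⟩


/-- Every structure that satisfies `PrA⁻` comes from a monoid, so that the theory of monoids can be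
applied to it. -/
theorem exists_isMinusModel {M : Type*} (S : presburger.Structure M) (h : M ⊨ PrAMinus) :
    ∃ (_ : AddCancelCommMonoid M) (_ : One M),
      S = @presburger.instStructure M _ _ _ ∧ IsMinusModel M := by
  -- the structure is determined by its constants and its addition
  obtain ⟨z, o, a, rfl⟩ : ∃ (z : Zero M) (o : One M) (a : Add M),
      S = @presburger.instStructure M z o a := by
    refine ⟨⟨Structure.funMap (L := presburger) presburgerFunc.zero ![]⟩,
      ⟨Structure.funMap (L := presburger) presburgerFunc.one ![]⟩,
      ⟨fun a b => Structure.funMap (L := presburger) presburgerFunc.add ![a, b]⟩, ?_⟩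
    refine Structure.ext ?_ ?_
    · funext n f xs
      cases f
      · exact congrArg _ (Subsingleton.elim _ _)
      · exact congrArg _ (Subsingleton.elim _ _)
      · refine congrArg _ ?_
        funext i
        fin_cases i <;> rfl
    · funext n R
      exact Empty.elim R
  simp [PrAMinus, Sentence.Realize, Formula.Realize, Fin.snoc] at h
  obtain ⟨h_assoc, h_comm, h_zero, h_cancel, h₁, h₂, h₃⟩ := h
  let i : AddCancelCommMonoid M :=
    { add := (· + ·)
      add_assoc := h_assoc
      zero := 0
      zero_add := fun a => (h_comm 0 a).trans (h_zero a)
      add_zero := h_zero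
      nsmul := nsmulRec
      add_comm := h_comm
      add_left_cancel := fun c a b hab => h_cancel a b c (by
        rw [h_comm a, h_comm b]; exact hab) }
  exact ⟨i, o, rfl, h₁, h₂, h₃⟩

/-! ### Multiplication by small numbers in models of `PrA⁻` -/

namespace IsMinusModel

variable {M : Type*} [AddCancelCommMonoid M] [One M] (h : IsMinusModel M)

include h

theorem eq_zero_of_add_eq_zero {a b : M} (hab : a + b = 0) : b = 0 := by
  by_contra hb
  obtain ⟨c, rfl⟩ := h.exists_eq_add_one b hb
  exact h.add_one_ne_zero (a + c) (by rw [add_assoc, hab])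

theorem nsmul_one_eq_zero {k : ℕ} (hk : k • (1 : M) = 0) : k = 0 := by
  cases k with
  | zero => rfl
  | succ k => exact (h.add_one_ne_zero _ (by rwa [succ_nsmul] at hk)).elim

theorem lt_of_nsmul_one_add {j k : ℕ} {e : M} (he : j • (1 : M) + e = k • (1 : M))
    (hne : j • (1 : M) ≠ k • (1 : M)) : j < k := by
  by_contra! hkj
  obtain ⟨i, rfl⟩ := Nat.exists_eq_add_of_le hkj
  have h₀ : e + i • (1 : M) = 0 := by
    rw [add_nsmul, add_assoc] at he
    rw [add_comm]
    exact add_eq_left.1 he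
  have : i = 0 := h.nsmul_one_eq_zero (h.eq_zero_of_add_eq_zero h₀)
  subst this
  exact hne rfl

theorem nsmul_one_injective {j k : ℕ} (hjk : j • (1 : M) = k • (1 : M)) : j = k := by
  wlog hle : j ≤ k generalizing j k
  · exact (this hjk.symm (by omega)).symm
  obtain ⟨i, rfl⟩ := Nat.exists_eq_add_of_le hle
  rw [add_nsmul, left_eq_add] at hjk
  rw [h.nsmul_one_eq_zero hjk, add_zero]

/-- The standard elements form an initial segment. -/
theorem exists_nsmul_one_of_add {e a : M} {k : ℕ} (hk : e + a = k • (1 : M)) :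
    ∃ j ≤ k, a = j • (1 : M) := by
  induction k generalizing a with
  | zero => exact ⟨0, le_rfl, by rw [zero_nsmul] at hk ⊢; exact h.eq_zero_of_add_eq_zero hk⟩
  | succ k ih =>
    by_cases ha : a = 0
    · exact ⟨0, Nat.zero_le _, by rw [ha, zero_nsmul]⟩
    obtain ⟨b, rfl⟩ := h.exists_eq_add_one a ha
    rw [succ_nsmul, ← add_assoc] at hk
    obtain ⟨j, hj, rfl⟩ := ih (add_right_cancel hk)
    exact ⟨j + 1, by omega, (succ_nsmul _ _).symm⟩

/-- In every model of `PrA⁻`, the formula `Mulₙ` defines multiplication by the standard numbers up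
to `2 ^ 2 ^ n`. -/
theorem realize_mul (n : ℕ) (v : Empty → M) (a b c : M) :
    (mul n).Realize v ![a, b, c] ↔ ∃ k ≤ 2 ^ 2 ^ n, b = k • (1 : M) ∧ c = k • a := by
  induction n generalizing a b c with
  | zero =>
    rw [mul, realize_mulZero]
    constructor
    · rintro ⟨h₀, h₁, h₂, hb | hb | hb⟩
      · exact ⟨0, by norm_num, by rw [hb, zero_nsmul], by rw [h₀ hb, zero_nsmul]⟩
      · exact ⟨1, by norm_num, by rw [hb, one_nsmul], by rw [h₁ hb, one_nsmul]⟩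
      · exact ⟨2, by norm_num, by rw [hb, two_nsmul], by rw [h₂ hb, two_nsmul]⟩
    · rintro ⟨k, hk, rfl, rfl⟩
      have e₂ : (1 : M) + 1 = 2 • 1 := (two_nsmul _).symm
      refine ⟨fun hk => ?_, fun hk => ?_, fun hk => ?_, ?_⟩
      · rw [h.nsmul_one_eq_zero hk, zero_nsmul]
      · rw [h.nsmul_one_injective (k := 1) (hk.trans (one_nsmul _).symm), one_nsmul]
      · rw [e₂] at hk
        rw [h.nsmul_one_injective hk, two_nsmul]
      · norm_num at hk
        interval_cases k
        · exact .inl (zero_nsmul _)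
        · exact .inr (.inl (one_nsmul _))
        · exact .inr (.inr (two_nsmul _))
  | succ n ih =>
    rw [mul, realize_mulStep]
    simp only [ih]
    have hN : 2 ^ 2 ^ (n + 1) = 2 ^ 2 ^ n * 2 ^ 2 ^ n := by rw [← pow_add, pow_succ, mul_two]
    have hpos : 0 < 2 ^ 2 ^ n := by positivity
    rw [hN]
    generalize 2 ^ 2 ^ n = N at hpos ⊢
    constructor
    · rintro ⟨y₁, y₂, y₃, y₄, z₁, z₂, z₄, rfl, ⟨⟨k₂, hk₂, rfl, rfl⟩, ⟨k₁, hk₁, rfl, rfl⟩,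
        ⟨k₂', -, hk₂', rfl⟩, ⟨k₄, hk₄, rfl, rfl⟩⟩, rfl, ⟨e, he⟩, hne⟩
      obtain rfl := h.nsmul_one_injective hk₂'
      have hlt := h.lt_of_nsmul_one_add he hne
      refine ⟨k₁ * k₂ + k₄, by nlinarith, ?_, ?_⟩
      · rw [add_nsmul, mul_nsmul]
      · rw [add_nsmul, mul_nsmul]
    · rintro ⟨k, hk, rfl, rfl⟩
      -- division of `k` by `N`, except that `N * N` is written `N * (N - 1) + N`
      obtain ⟨k₂, k₄, hk₂, hk₄, rfl⟩ : ∃ k₂ k₄, k₂ < N ∧ k₄ ≤ N ∧ k = N * k₂ + k₄ := by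
        rcases hk.eq_or_lt with rfl | hk
        · refine ⟨N - 1, N, by omega, le_rfl, ?_⟩
          obtain ⟨m, rfl⟩ := Nat.exists_eq_succ_of_ne_zero hpos.ne'
          simp [Nat.mul_succ]
        · exact ⟨k / N, k % N, Nat.div_lt_of_lt_mul hk, (Nat.mod_lt _ hpos).le,
            (Nat.div_add_mod _ _).symm⟩
      refine ⟨N • (1 : M), k₂ • (1 : M), k₂ • (N • (1 : M)), k₄ • (1 : M), N • a, k₂ • (N • a),
        k₄ • a, ?_, ⟨⟨k₂, hk₂.le, rfl, rfl⟩, ⟨N, le_rfl, rfl, rfl⟩, ⟨k₂, hk₂.le, rfl, rfl⟩,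
        ⟨k₄, hk₄, rfl, rfl⟩⟩, ?_, ⟨(N - k₂) • (1 : M), ?_⟩,
        fun he => hk₂.ne (h.nsmul_one_injective he)⟩
      · rw [add_nsmul, mul_nsmul]
      · rw [add_nsmul, mul_nsmul]
      · rw [← add_nsmul, Nat.add_sub_cancel' hk₂.le]

theorem hypHolds_mul {n k : ℕ} (hk : k ≤ 2 ^ 2 ^ n) :
    HypHolds (fun a b c : M => (mul n).Realize default ![a, b, c]) (k • (1 : M)) := by
  simp only [HypHolds, h.realize_mul]
  refine ⟨⟨k, hk, rfl, rfl⟩, ⟨k, hk, rfl, (nsmul_zero k).symm⟩, fun a => ⟨k • a,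
    ⟨k, hk, rfl, rfl⟩, ?_⟩, fun a₁ a₂ => ⟨k • a₁, k • a₂, ⟨k, hk, rfl, rfl⟩, ⟨k, hk, rfl, rfl⟩,
    ⟨k, hk, rfl, (nsmul_add _ _ _).symm⟩⟩⟩
  rintro d ⟨j, -, hj, rfl⟩
  rw [h.nsmul_one_injective hj]

/-- In a model of `PrA⁻`, `σₙ` holds if and only if division with remainder by each nonzero
standard number up to `2 ^ 2 ^ n` is possible. -/
theorem realize_divSentence_iff (n : ℕ) : M ⊨ divSentence n ↔
    ∀ k ≤ 2 ^ 2 ^ n, k ≠ 0 → ∀ a : M, ∃ q, ∃ i < k, a = k • q + i • (1 : M) := by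
  rw [realize_divSentence]
  constructor
  · intro H k hk hk0 a
    rcases H a _ (h.hypHolds_mul hk) with h₀ | ⟨q, c, r, hqc, rfl, ⟨e, he⟩, hne⟩
    · exact (hk0 (h.nsmul_one_eq_zero h₀)).elim
    · obtain ⟨k', -, hk', rfl⟩ := (h.realize_mul n _ _ _ _).1 hqc
      obtain rfl := h.nsmul_one_injective hk'
      obtain ⟨j, -, rfl⟩ := h.exists_nsmul_one_of_add (e := e) (a := r) (by rw [add_comm, he])
      exact ⟨q, j, h.lt_of_nsmul_one_add he hne, rfl⟩
  · intro H a b hb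
    obtain ⟨k, hk, rfl, -⟩ := (h.realize_mul n _ _ _ _).1 hb.2.1
    by_cases hk0 : k = 0
    · exact .inl (by rw [hk0, zero_nsmul])
    obtain ⟨q, i, hi, rfl⟩ := H k hk hk0 a
    refine .inr ⟨q, k • q, i • (1 : M), (h.realize_mul n _ _ _ _).2 ⟨k, hk, rfl, rfl⟩, rfl,
      ⟨(k - i) • (1 : M), ?_⟩, fun he => hi.ne (h.nsmul_one_injective he)⟩
    rw [← add_nsmul, Nat.add_sub_cancel' hi.le]

omit h in
theorem realize_modAxiom {p : ℕ} (hp : 0 < p) : M ⊨ modAxiom p ↔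
    ∀ a : M, ∃ i < p, ∃ c : M, p • c + i • (1 : M) = a ∨ p • c + a = i • (1 : M) := by
  simp only [modAxiom, Sentence.Realize, Formula.Realize, BoundedFormula.realize_all,
    realize_disj, Nat.le_sub_one_iff_lt hp]
  refine forall_congr' fun a => exists_congr fun i => and_congr_right fun _ => ?_
  simp [modEq, realize_mulNat, numeral, Fin.snoc]

theorem division_of_modAxiom {p : ℕ} (hp : p.Prime) (H : M ⊨ modAxiom p) (a : M) :
    ∃ q, ∃ i < p, a = p • q + i • (1 : M) := by
  obtain ⟨i, hi, c, rfl | hc⟩ := (realize_modAxiom hp.pos).1 H a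
  · exact ⟨c, i, hi, rfl⟩
  · obtain ⟨j, hj, rfl⟩ := h.exists_nsmul_one_of_add hc
    exact ⟨0, j, hj.trans_lt hi, by rw [nsmul_zero, zero_add]⟩

omit h in
theorem division_of_prime_division
    (H : ∀ p : ℕ, p.Prime → ∀ a : M, ∃ q, ∃ i < p, a = p • q + i • (1 : M)) (k : ℕ) :
    k ≠ 0 → ∀ a : M, ∃ q, ∃ i < k, a = k • q + i • (1 : M) := by
  induction k using induction_on_primes with
  | zero => exact fun h0 => (h0 rfl).elim
  | one => exact fun _ a => ⟨a, 0, one_pos, by simp⟩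
  | prime_mul p m hp ih =>
    intro hpm a
    obtain ⟨c, i, hi, rfl⟩ := H p hp a
    obtain ⟨q, j, hj, rfl⟩ := ih (right_ne_zero_of_mul hpm) c
    refine ⟨q, p * j + i, by nlinarith, ?_⟩
    simp only [nsmul_add, mul_nsmul', add_nsmul, add_assoc]

end IsMinusModel

instance {l : ℕ} : Countable (presburger.Functions l) :=
  Function.Injective.countable (f := fun f : presburgerFunc l => match f with
    | .zero => (0 : ℕ) | .one => 1 | .add => 2) (by
      intro f g
      cases f <;> cases g <;> first | exact fun _ => rfl | simp)

instance {k l : ℕ} : Countable (OneRel k l) :=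
  @Finite.to_countable _ (@Finite.of_subsingleton _ ⟨by rintro ⟨⟩ ⟨⟩; rfl⟩)

instance {l : ℕ} : Countable (presburger.Relations l) := inferInstanceAs (Countable Empty)

instance : Countable presburger.Symbols :=
  inferInstanceAs (Countable ((Σ l, presburger.Functions l) ⊕ Σ l, presburger.Relations l))

instance {k : ℕ} : Countable (withRel presburger k).Symbols :=
  inferInstanceAs (Countable ((Σ l, presburger.Functions l ⊕ Empty) ⊕
    Σ l, presburger.Relations l ⊕ OneRel k l))

theorem provable_PrAAlt_divSentence (n : ℕ) : Provable PrAAlt (divSentence n) := by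
  refine completeness fun M S _ hM => ?_
  have hM' := (Theory.model_iff _).1 hM
  obtain ⟨_, _, rfl, h⟩ := exists_isMinusModel S (hM.mono Set.subset_union_left)
  rw [h.realize_divSentence_iff]
  exact fun k _ => IsMinusModel.division_of_prime_division
    (fun p hp => h.division_of_modAxiom hp (hM' _ (.inr ⟨p, hp, rfl⟩))) k

/-! ### A model in which exactly one prime fails to divide with remainder -/

/-- The nonnegative elements of the lexicographically ordered group `ℤ₍ₚ₎ × ℤ`, where `ℤ₍ₚ₎` is the
ring of the rational numbers whose denominator is prime to `p`. -/
def localModel (p : ℕ) [hp : Fact p.Prime] : AddSubmonoid (ℚ × ℤ) where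
  carrier := {a | (∃ m : ℕ, ¬ p ∣ m ∧ ∃ z : ℤ, m * a.1 = z) ∧ (0 < a.1 ∨ a.1 = 0 ∧ 0 ≤ a.2)}
  zero_mem' := ⟨⟨1, hp.out.one_lt.not_ge ∘ Nat.le_of_dvd one_pos, 0, by simp⟩, .inr ⟨rfl, le_rfl⟩⟩
  add_mem' := by
    rintro ⟨r, k⟩ ⟨s, l⟩ ⟨⟨m₁, hm₁, z₁, h₁⟩, ha⟩ ⟨⟨m₂, hm₂, z₂, h₂⟩, hb⟩
    simp only at h₁ h₂ ha hb
    refine ⟨⟨m₁ * m₂, fun h => (hp.out.dvd_mul.1 h).elim hm₁ hm₂, m₂ * z₁ + m₁ * z₂, ?_⟩, ?_⟩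
    · push_cast
      rw [← h₁, ← h₂, Prod.fst_add]
      ring
    · simp only [Prod.mk_add_mk]
      rcases ha with ha | ⟨rfl, ha⟩ <;> rcases hb with hb | ⟨rfl, hb⟩
      · exact .inl (add_pos ha hb)
      · exact .inl (by rwa [add_zero])
      · exact .inl (by rwa [zero_add])
      · exact .inr ⟨add_zero _, add_nonneg ha hb⟩

namespace localModel

variable {p : ℕ} [hp : Fact p.Prime]

theorem integer_mem {k : ℤ} (hk : 0 ≤ k) : ((0, k) : ℚ × ℤ) ∈ localModel p :=
  ⟨⟨1, hp.out.one_lt.not_ge ∘ Nat.le_of_dvd one_pos, 0, by simp⟩, .inr ⟨rfl, hk⟩⟩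

instance : One (localModel p) := ⟨⟨(0, 1), integer_mem zero_le_one⟩⟩

instance : AddCancelCommMonoid (localModel p) :=
  { (localModel p).toAddCommMonoid with
    add_left_cancel := fun _ _ _ h => Subtype.ext (add_left_cancel (congrArg Subtype.val h)) }

theorem sub_mem {a b : ℚ × ℤ} (ha : a ∈ localModel p) (hb : b ∈ localModel p)
    (h : 0 < a.1 - b.1 ∨ a.1 - b.1 = 0 ∧ 0 ≤ a.2 - b.2) : a - b ∈ localModel p := by
  obtain ⟨⟨m₁, hm₁, z₁, h₁⟩, -⟩ := ha
  obtain ⟨⟨m₂, hm₂, z₂, h₂⟩, -⟩ := hb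
  refine ⟨⟨m₁ * m₂, fun h => (hp.out.dvd_mul.1 h).elim hm₁ hm₂, m₂ * z₁ - m₁ * z₂, ?_⟩, h⟩
  push_cast
  rw [← h₁, ← h₂, Prod.fst_sub]
  ring

theorem total (a b : localModel p) : (∃ c, a + c = b) ∨ ∃ c, b + c = a := by
  rcases lt_trichotomy (a : ℚ × ℤ).1 (b : ℚ × ℤ).1 with h | h | h
  · exact .inl ⟨⟨_, sub_mem b.2 a.2 (.inl (sub_pos.2 h))⟩, Subtype.ext (add_sub_cancel _ _)⟩
  · rcases le_total (a : ℚ × ℤ).2 (b : ℚ × ℤ).2 with h' | h'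
    · exact .inl ⟨⟨_, sub_mem b.2 a.2 (.inr ⟨sub_eq_zero.2 h.symm, sub_nonneg.2 h'⟩)⟩,
        Subtype.ext (add_sub_cancel _ _)⟩
    · exact .inr ⟨⟨_, sub_mem a.2 b.2 (.inr ⟨sub_eq_zero.2 h, sub_nonneg.2 h'⟩)⟩,
        Subtype.ext (add_sub_cancel _ _)⟩
  · exact .inr ⟨⟨_, sub_mem a.2 b.2 (.inl (sub_pos.2 h))⟩, Subtype.ext (add_sub_cancel _ _)⟩

theorem isMinusModel : IsMinusModel (localModel p) where
  add_one_ne_zero := by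
    rintro ⟨⟨r, k⟩, _, ha⟩ h
    have h₁ : r + 0 = 0 := congrArg (fun a : localModel p => (a : ℚ × ℤ).1) h
    have h₂ : k + 1 = 0 := congrArg (fun a : localModel p => (a : ℚ × ℤ).2) h
    rcases ha with ha | ⟨-, ha⟩
    · exact ha.ne' ((add_zero r).symm.trans h₁)
    · simp only at ha
      omega
  exists_eq_add_one := by
    rintro ⟨⟨r, k⟩, ha⟩ h
    refine ⟨⟨(r, k) - (0, 1), sub_mem ha (integer_mem zero_le_one) ?_⟩,
      Subtype.ext (sub_add_cancel _ _).symm⟩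
    rcases ha.2 with h' | ⟨h₀, h'⟩
    · exact .inl (by simpa using h')
    · refine .inr ⟨by simpa using h₀, ?_⟩
      simp only at h₀ h' ⊢
      have : k ≠ 0 := by
        rintro rfl
        exact h (Subtype.ext (Prod.ext h₀ rfl))
      omega
  total := total

theorem model_modAxiom {q : ℕ} (hq : q.Prime) (hqp : q ≠ p) : localModel p ⊨ modAxiom q := by
  rw [IsMinusModel.realize_modAxiom hq.pos]
  rintro ⟨⟨r, k⟩, ⟨m, hm, z, hz⟩, ha⟩
  have hq0 : (0 : ℤ) < q := by exact_mod_cast hq.pos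
  have hq0' : (0 : ℚ) < q := by exact_mod_cast hq.pos
  refine ⟨(k % q).toNat, ?_, ⟨(r / q, k / q), ⟨m * q, fun h => ?_, z, ?_⟩, ?_⟩,
    .inl (Subtype.ext ?_)⟩
  · have := Int.emod_lt_of_pos k hq0
    have := Int.emod_nonneg k hq0.ne'
    omega
  · exact (hp.out.dvd_mul.1 h).elim hm fun h =>
      hqp ((Nat.prime_dvd_prime_iff_eq hp.out hq).1 h).symm
  · rw [← hz]
    push_cast
    field_simp
  · rcases ha with ha | ⟨rfl, ha⟩
    · exact .inl (div_pos ha hq0')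
    · exact .inr ⟨zero_div _, Int.ediv_nonneg ha hq0.le⟩
  · refine Prod.ext (?_ : q • (r / q) + (k % q).toNat • (0 : ℚ) = r)
      (?_ : q • (k / q) + (k % q).toNat • (1 : ℤ) = k)
    · rw [smul_zero, add_zero, nsmul_eq_mul]
      field_simp
    · rw [nsmul_eq_mul, nsmul_eq_mul, Int.toNat_of_nonneg (Int.emod_nonneg k hq0.ne'), mul_one,
        Int.mul_ediv_add_emod]

theorem not_realize_divSentence {n : ℕ} (hpn : p ≤ 2 ^ 2 ^ n) :
    ¬ localModel p ⊨ divSentence n := by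
  rw [isMinusModel.realize_divSentence_iff]
  intro H
  -- the element `(1, 0)` is not a multiple of `p` plus a standard number
  obtain ⟨⟨⟨r, k⟩, ⟨m, hm, z, hz⟩, _⟩, i, -, h⟩ := H p hpn hp.out.ne_zero
    ⟨(1, 0), ⟨1, hp.out.one_lt.not_ge ∘ Nat.le_of_dvd one_pos, 1, by simp⟩, .inl one_pos⟩
  have h₁ : (1 : ℚ) = p • r + i • (0 : ℚ) := congrArg (fun a : localModel p => (a : ℚ × ℤ).1) h
  rw [smul_zero, add_zero, nsmul_eq_mul] at h₁
  refine hm (Int.natCast_dvd_natCast.1 ⟨z, ?_⟩)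
  have : (m : ℚ) = p * z := by rw [← hz, mul_left_comm, ← h₁, mul_one]
  exact_mod_cast this

end localModel

theorem Derivation.used_subset {L : FirstOrder.Language.{u, v}} {T : L.Theory}
    {Γ : List (L.Formula ℕ)} {φ : L.Formula ℕ} (d : Derivation T Γ φ) : d.used ⊆ T := by
  induction d with
  | ax σ h => exact Set.singleton_subset_iff.2 h
  | hyp φ h => exact Set.empty_subset _
  | eqI t => exact Set.empty_subset _
  | impI d ih => exact ih
  | raa d ih => exact ih
  | allI a _ _ d ih => exact ih
  | allE t d ih => exact ih
  | impE d e ihd ihe => exact Set.union_subset ihd ihe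
  | eqE φ d e ihd ihe => exact Set.union_subset ihd ihe

theorem modAxiom_mem_used {n p : ℕ} (hp : p.Prime) (hpn : p ≤ 2 ^ 2 ^ n)
    (d : Proof PrAAlt (divSentence n)) : modAxiom p ∈ d.used := by
  by_contra hd
  have := Fact.mk hp
  refine localModel.not_realize_divSentence (p := p) hpn ?_
  rw [← realize_ofSentence _ (fun _ => 0) Fin.elim0]
  refine d.sound (fun σ hσ => ?_) _ _ (by simp)
  rcases d.used_subset hσ with h | ⟨q, hq, rfl⟩
  · exact (Theory.model_iff _).1 localModel.isMinusModel.model σ h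
  · exact localModel.model_modAxiom hq (by rintro rfl; exact hd hσ)

theorem le_nodes_disj {n : ℕ} (φ : ℕ → presburger.BoundedFormula Empty n) (k : ℕ) :
    k + 1 ≤ nodes (disj φ k) := by
  induction k with
  | zero => exact one_le_nodes _
  | succ k ih =>
    have h : nodes (disj φ (k + 1)) = 1 + (1 + nodes (disj φ k) + 1) + nodes (φ (k + 1)) := rfl
    omega

theorem lt_sentenceSize_modAxiom {p : ℕ} : p < sentenceSize (modAxiom p) := by
  refine lt_of_lt_of_le ?_ (nodes_le_sentenceSize _)
  have h := le_nodes_disj (fun i => modEq p (x 0) (numeral i)) (n := 1) (p - 1)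
  simp only [modAxiom, nodes]
  omega

/-- A proof of `σₙ` uses the axiom for a prime between `2 ^ (2 ^ n - 1)` and `2 ^ 2 ^ n`. -/
theorem exists_used_large (n : ℕ) (d : Proof PrAAlt (divSentence n)) :
    ∃ σ ∈ d.used, 2 ^ (2 ^ n - 1) < sentenceSize σ := by
  obtain ⟨p, hp, hlt, hle⟩ := Nat.exists_prime_lt_and_le_two_mul (2 ^ (2 ^ n - 1)) (by positivity)
  rw [← pow_succ', Nat.sub_add_cancel Nat.one_le_two_pow] at hle
  exact ⟨_, modAxiom_mem_used hp hle d, hlt.trans lt_sentenceSize_modAxiom⟩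

/-! ### Short proofs by induction -/

section Reduct

variable {L : FirstOrder.Language.{0, 0}} {k : ℕ} {α : Type}

theorem reductTerm_onTerm {α : Type*} (t : L.Term α) :
    reductTerm ((LHom.sumInl : L →ᴸ withRel L k).onTerm t) = t := by
  induction t with
  | var a => rfl
  | func f ts ih => exact congrArg _ (funext ih)

theorem interpret_onBoundedFormula (I : L.BoundedFormula Empty k) {n : ℕ}
    (φ : L.BoundedFormula α n) :
    interpret I ((LHom.sumInl : L →ᴸ withRel L k).onBoundedFormula φ) = φ := by
  induction φ with
  | falsum => rfl
  | equal t₁ t₂ =>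
    exact congrArg₂ _ (reductTerm_onTerm t₁) (reductTerm_onTerm t₂)
  | rel R ts => exact congrArg _ (funext fun i => reductTerm_onTerm (ts i))
  | imp φ ψ ih₁ ih₂ => exact congrArg₂ _ ih₁ ih₂
  | all φ ih => exact congrArg _ ih

end Reduct

section Template

/-- The language `0, 1, +` together with a ternary relation symbol, which stands for `Mulₙ`. -/
abbrev mulLang : FirstOrder.Language.{0, 0} := withRel presburger 3

/-- A formula of the language `0, 1, +`, in the language with the additional symbol. -/
abbrev lift {n : ℕ} (φ : presburger.BoundedFormula Empty n) : mulLang.BoundedFormula Empty n :=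
  (LHom.sumInl : presburger →ᴸ mulLang).onBoundedFormula φ

/-- The additional relation symbol, applied to terms. -/
def mulRel {n : ℕ} (r s t : presburger.Term (Empty ⊕ Fin n)) : mulLang.BoundedFormula Empty n :=
  BoundedFormula.rel (L := mulLang) (Sum.inr OneRel.sym)
    fun i => (LHom.sumInl : presburger →ᴸ mulLang).onTerm (![r, s, t] i)

/-- The formula `Hyp`, with the additional relation symbol in the place of `Mulₙ`. -/
def hypTemplate : mulLang.BoundedFormula Empty 1 :=
  mulRel 1 (x 0) (x 0) ⊓
  (mulRel 0 (x 0) 0 ⊓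
  ((∀' ∃' (mulRel (x 1) (x 0) (x 2) ⊓
      ∀' (mulRel (x 1) (x 0) (x 3) ⟹ lift (x 3 =' x 2)))) ⊓
  ∀' ∀' ∀' (lift (x 1 =' (x 2 + x 3)) ⟹
    ∃' ∃' ∃' ((mulRel (x 2) (x 0) (x 5) ⊓ mulRel (x 3) (x 0) (x 6)) ⊓
      (mulRel (x 1) (x 0) (x 4) ⊓ lift (x 4 =' (x 5 + x 6)))))))

/-- A formula in one variable, applied to a term of the language `0, 1, +`. -/
def appLift {n : ℕ} (φ : mulLang.BoundedFormula Empty 1) (t : presburger.Term (Empty ⊕ Fin n)) :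
    mulLang.BoundedFormula Empty n :=
  app φ fun _ => (LHom.sumInl : presburger →ᴸ mulLang).onTerm t

/-- The formula `Div`, with the additional relation symbol in the place of `Mulₙ`. -/
def divTemplate : mulLang.BoundedFormula Empty 1 :=
  ∀' (appLift hypTemplate (x 1) ⟹
    (lift (x 1 =' 0) ⊔
      ∃' ∃' ∃' (mulRel (x 2) (x 1) (x 3) ⊓ (lift (x 0 =' (x 3 + x 4)) ⊓ lift (lt (x 4) (x 1))))))

/-- The induction axiom for `Div`, with the additional relation symbol in the place of `Mulₙ`. -/
def inductionTemplate : mulLang.Sentence :=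
  (appLift divTemplate 0 ⊓ ∀' (divTemplate ⟹ appLift divTemplate (x 0 + 1))) ⟹ ∀' divTemplate

/-- The axioms of `PrA⁻` and the induction axiom for `Div`. -/
def theoryTemplate : mulLang.Theory :=
  (LHom.sumInl : presburger →ᴸ mulLang).onTheory PrAMinus ∪ {inductionTemplate}

variable (I : presburger.BoundedFormula Empty 3)

section Interpret

variable {α : Type} {n : ℕ}

theorem interpret_imp (φ ψ : mulLang.BoundedFormula α n) :
    interpret I (φ ⟹ ψ) = (interpret I φ ⟹ interpret I ψ) := rfl

theorem interpret_inf (φ ψ : mulLang.BoundedFormula α n) :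
    interpret I (φ ⊓ ψ) = interpret I φ ⊓ interpret I ψ := rfl

theorem interpret_sup (φ ψ : mulLang.BoundedFormula α n) :
    interpret I (φ ⊔ ψ) = interpret I φ ⊔ interpret I ψ := rfl

theorem interpret_all (φ : mulLang.BoundedFormula α (n + 1)) :
    interpret I (∀' φ) = ∀' (interpret I φ) := rfl

theorem interpret_ex (φ : mulLang.BoundedFormula α (n + 1)) :
    interpret I (∃' φ) = ∃' (interpret I φ) := rfl

theorem interpret_mulRel (r s t : presburger.Term (Empty ⊕ Fin n)) :
    interpret I (mulRel r s t) = app₃ I r s t := by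
  simp only [mulRel, interpret, reductTerm_onTerm]
  rfl

theorem interpret_appLift (φ : mulLang.BoundedFormula Empty 1)
    (t : presburger.Term (Empty ⊕ Fin n)) :
    interpret I (appLift φ t) = app₁ (interpret I φ) t := by
  rw [appLift, interpret_app, app₁]
  congr 1
  funext i
  rw [reductTerm_onTerm, Subsingleton.elim i 0]
  rfl

end Interpret

theorem interpret_divTemplate (n : ℕ) : interpret (mul n) divTemplate = div n := by
  simp only [divTemplate, hypTemplate, interpret_imp, interpret_inf, interpret_sup, interpret_all,
    interpret_ex, interpret_mulRel, interpret_appLift, interpret_onBoundedFormula, div, hyp]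

theorem interpret_inductionTemplate (n : ℕ) :
    interpret (mul n) inductionTemplate = induction (k := 0) (div n) := by
  simp only [inductionTemplate, interpret_imp, interpret_inf, interpret_all, interpret_appLift,
    interpret_divTemplate, induction, app₁, BoundedFormula.alls]
  congr 4
  funext i
  rw [Subsingleton.elim i 0]
  rfl

theorem interpret_mem_PrA (n : ℕ) {σ : mulLang.Sentence} (hσ : σ ∈ theoryTemplate) :
    interpret (mul n) σ ∈ PrA := by
  rcases hσ with ⟨τ, hτ, rfl⟩ | rfl
  · rw [LHom.onSentence, LHom.onFormula, interpret_onBoundedFormula]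
    exact .inl hτ
  · exact .inr ⟨0, div n, interpret_inductionTemplate n⟩

section Realize

variable {M : Type} [Zero M] [One M] [Add M] [mulLang.Structure M]
  [(LHom.sumInl : presburger →ᴸ mulLang).IsExpansionOn M]

/-- The relation by which the additional symbol is interpreted. -/
def relOf (a b c : M) : Prop :=
  Structure.RelMap (L := mulLang) (M := M) (Sum.inr OneRel.sym : mulLang.Relations 3) ![a, b, c]

theorem realize_mulRel {n : ℕ} (r s t : presburger.Term (Empty ⊕ Fin n)) (v : Empty → M)
    (xs : Fin n → M) : (mulRel r s t).Realize v xs ↔ relOf (r.realize (Sum.elim v xs))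
      (s.realize (Sum.elim v xs)) (t.realize (Sum.elim v xs)) := by
  rw [mulRel]
  refine BoundedFormula.realize_rel.trans (iff_of_eq (congrArg _ ?_))
  funext i
  rw [LHom.realize_onTerm]
  fin_cases i <;> rfl

theorem realize_appLift {n : ℕ} (φ : mulLang.BoundedFormula Empty 1)
    (t : presburger.Term (Empty ⊕ Fin n)) (v : Empty → M) (xs : Fin n → M) :
    (appLift φ t).Realize v xs ↔ φ.Realize v fun _ => t.realize (Sum.elim v xs) := by
  rw [appLift, realize_app]
  simp only [LHom.realize_onTerm]

theorem realize_hypTemplate (v : Empty → M) (xs : Fin 1 → M) :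
    hypTemplate.Realize v xs ↔ HypHolds relOf (xs 0) := by
  simp [hypTemplate, HypHolds, Fin.snoc, realize_mulRel]
  intro _ _ _
  constructor
  · intro h a₁ a₂
    obtain ⟨c₁, c₂, ⟨h₁, h₂⟩, h₃⟩ := h (a₁ + a₂) a₁ a₂ rfl
    exact ⟨c₁, h₁, c₂, h₂, h₃⟩
  · rintro h a a₁ a₂ rfl
    obtain ⟨c₁, h₁, c₂, h₂, h₃⟩ := h a₁ a₂
    exact ⟨c₁, c₂, ⟨h₁, h₂⟩, h₃⟩

theorem realize_divTemplate (v : Empty → M) (xs : Fin 1 → M) :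
    divTemplate.Realize v xs ↔ DivHolds relOf (xs 0) := by
  simp [divTemplate, DivHolds, Fin.snoc, realize_mulRel, realize_appLift, realize_hypTemplate]

theorem realize_inductionTemplate (h : M ⊨ inductionTemplate) (h₀ : DivHolds relOf (0 : M))
    (h₁ : ∀ a : M, DivHolds relOf a → DivHolds relOf (a + 1)) (a : M) : DivHolds relOf a := by
  simp [inductionTemplate, Sentence.Realize, Formula.Realize, realize_appLift,
    realize_divTemplate] at h
  exact h h₀ h₁ a

end Realize

/-- `Div` is inductive, whatever relation is put in the place of `Mulₙ`. -/
theorem IsMinusModel.divHolds_succ {M : Type*} [AddCancelCommMonoid M] [One M]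
    (h : IsMinusModel M) (R : M → M → M → Prop) (a : M) (ha : DivHolds R a) :
    DivHolds R (a + 1) := by
  intro b hb
  rcases ha b hb with h0 | ⟨q, c, r, hR, rfl, ⟨e, he⟩, hne⟩
  · exact .inl h0
  right
  obtain ⟨e, rfl⟩ := h.exists_eq_add_one e (by rintro rfl; exact hne (by rwa [add_zero] at he))
  -- either the remainder stays below `b`, or it becomes `0` and the quotient grows by `1`
  by_cases hr : r + 1 = b
  · obtain ⟨c₁, c₂, hc₁, hc₂, hc⟩ := hb.2.2.2 q 1
    obtain ⟨d, -, hd⟩ := hb.2.2.1 q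
    obtain ⟨d', -, hd'⟩ := hb.2.2.1 1
    obtain rfl : c₁ = c := (hd _ hc₁).trans (hd _ hR).symm
    obtain rfl : c₂ = b := (hd' _ hc₂).trans (hd' _ hb.1).symm
    refine ⟨q + 1, c₁ + c₂, 0, hc, by rw [add_zero, ← hr, add_assoc], ⟨c₂, zero_add _⟩, ?_⟩
    rintro rfl
    exact h.add_one_ne_zero r hr
  · exact ⟨q, c, r + 1, hR, add_assoc _ _ _, ⟨e, by rw [← he, add_assoc, add_comm 1]⟩, hr⟩

theorem divHolds_zero {M : Type*} [AddCancelCommMonoid M] [One M] (R : M → M → M → Prop) :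
    DivHolds R 0 := by
  intro b hb
  by_cases h : b = 0
  · exact .inl h
  · exact .inr ⟨0, 0, 0, hb.2.1, (add_zero 0).symm, ⟨b, zero_add b⟩, Ne.symm h⟩

theorem provable_divTemplate : Provable theoryTemplate (∀' divTemplate) := by
  refine completeness fun M S _ hM => ?_
  let S' : presburger.Structure M := (LHom.sumInl : presburger →ᴸ mulLang).reduct M
  have hE : (LHom.sumInl : presburger →ᴸ mulLang).IsExpansionOn M := inferInstance
  have hM' := hM.mono Set.subset_union_left
  have hind : M ⊨ inductionTemplate := (Theory.model_iff _).1 hM _ (.inr rfl)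
  rw [LHom.onTheory_model] at hM'
  clear_value S'
  obtain ⟨_, _, rfl, h⟩ := exists_isMinusModel S' hM'
  rw [Sentence.Realize, Formula.Realize, BoundedFormula.realize_all]
  exact fun a => (realize_divTemplate _ _).2 (realize_inductionTemplate hind (divHolds_zero _)
    (h.divHolds_succ _) _)

end Template

/-- One derivation of `Div` for an unspecified relation gives short proofs of all the `σₙ`. -/
theorem exists_bound_of_mul :
    ∃ C, ∀ n, ∃ d : Proof PrA (divSentence n),
      d.size ≤ C * (nodes (mul n) * (quantDepth (mul n) + 1)) := by
  obtain ⟨d⟩ := provable_divTemplate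
  obtain ⟨C, hC⟩ := d.exists_interpret (T := PrA)
  refine ⟨C, fun n => ?_⟩
  have := hC (mul n) fun σ hσ => interpret_mem_PrA n hσ
  rwa [interpret_ofSentence, interpret_all, interpret_divTemplate] at this

theorem nodes_app₃ {n : ℕ} (I : presburger.BoundedFormula Empty 3) (i j k : Fin n) :
    nodes (app₃ I (x i) (x j) (x k)) = nodes I := by
  refine nodes_substAll _ _ fun a => ?_
  rcases a with a | a
  · exact a.elim
  · fin_cases a <;> rfl

section Connectives

variable {L : FirstOrder.Language.{u, v}} {α : Type} {n : ℕ}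

theorem nodes_inf (φ ψ : L.BoundedFormula α n) : nodes (φ ⊓ ψ) = nodes φ + nodes ψ + 5 := by
  have h : nodes (φ ⊓ ψ) = 1 + (1 + nodes φ + (1 + nodes ψ + 1)) + 1 := rfl
  omega

theorem nodes_ex (φ : L.BoundedFormula α (n + 1)) : nodes (∃' φ) = nodes φ + 5 := by
  have h : nodes (∃' φ) = 1 + (1 + (1 + nodes φ + 1)) + 1 := rfl
  omega

theorem quantDepth_inf (φ ψ : L.BoundedFormula α n) :
    quantDepth (φ ⊓ ψ) = max (quantDepth φ) (quantDepth ψ) := by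
  have h : quantDepth (φ ⊓ ψ) = max (max (quantDepth φ) (max (quantDepth ψ) 0)) 0 := rfl
  omega

theorem quantDepth_sup (φ ψ : L.BoundedFormula α n) :
    quantDepth (φ ⊔ ψ) = max (quantDepth φ) (quantDepth ψ) := by
  have h : quantDepth (φ ⊔ ψ) = max (max (quantDepth φ) 0) (quantDepth ψ) := rfl
  omega

theorem quantDepth_ex (φ : L.BoundedFormula α (n + 1)) :
    quantDepth (∃' φ) = quantDepth φ + 1 := by
  have h : quantDepth (∃' φ) = max (max (quantDepth φ) 0 + 1) 0 := rfl
  omega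

end Connectives

/-- Since `M` occurs only once in `mulStep M`, the formula grows by a constant number of symbols. -/
theorem nodes_mulStep (I : presburger.BoundedFormula Empty 3) :
    nodes (mulStep I) = nodes I + (nodes (mulStep ⊥) - 1) := by
  simp only [mulStep, nodes_ex, nodes_inf, nodes, nodes_app₃]
  omega

theorem quantDepth_mulStep (I : presburger.BoundedFormula Empty 3) :
    quantDepth (mulStep I) ≤ quantDepth I + 11 := by
  have h₁ : ∀ {n : ℕ} (s t : presburger.Term (Empty ⊕ Fin n)), quantDepth (s =' t) = 0 :=
    fun _ _ => rfl
  have h₂ : ∀ {n : ℕ} (s t : presburger.Term (Empty ⊕ Fin n)), quantDepth (lt s t) = 1 :=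
    fun _ _ => rfl
  simp only [mulStep, quantDepth_ex, quantDepth_inf, quantDepth_sup, quantDepth, h₁, h₂, app₃,
    app, quantDepth_substAll]
  omega

theorem nodes_mul (n : ℕ) :
    nodes (mul n) = nodes mulZero + n * (nodes (mulStep ⊥) - 1) := by
  induction n with
  | zero => simp [mul]
  | succ n ih => rw [mul, nodes_mulStep, ih]; ring

theorem quantDepth_mul_le (n : ℕ) : quantDepth (mul n) ≤ quantDepth mulZero + n * 11 := by
  induction n with
  | zero => simp [mul]
  | succ n ih => rw [mul]; exact (quantDepth_mulStep _).trans (by omega)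

theorem exists_polynomial_bound : ∃ P : Polynomial ℕ, ∀ n : ℕ,
    ∃ d : Proof PrA (divSentence n), d.size ≤ P.eval n := by
  obtain ⟨C, hC⟩ := exists_bound_of_mul
  -- the bounds `nodes_mul` and `quantDepth_mul_le`, put into `exists_bound_of_mul`
  refine ⟨.C C * ((.C (nodes mulZero) + .X * .C (nodes (mulStep ⊥) - 1)) *
    (.C (quantDepth mulZero) + .X * .C 11 + 1)), fun n => ?_⟩
  obtain ⟨d, hd⟩ := hC n
  refine ⟨d, hd.trans ?_⟩
  simp only [Polynomial.eval_mul, Polynomial.eval_add, Polynomial.eval_C, Polynomial.eval_X,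
    Polynomial.eval_one, nodes_mul]
  gcongr
  exact quantDepth_mul_le n

/-! ### The speedup -/

theorem le_nodes_mul (n : ℕ) : n ≤ nodes (mul n) := by
  have h : 1 ≤ nodes (mulStep ⊥) - 1 := by
    simp only [mulStep, nodes_ex, nodes_inf]
    omega
  rw [nodes_mul]
  nlinarith

theorem le_sentenceSize_divSentence (n : ℕ) : n + 16 ≤ sentenceSize (divSentence n) := by
  refine le_trans ?_ (nodes_le_sentenceSize _)
  have h₁ := le_nodes_mul n
  have h₂ : ∀ φ ψ : presburger.BoundedFormula Empty 2,
      nodes (φ ⊔ ψ) = 1 + (1 + nodes φ + 1) + nodes ψ := fun _ _ => rfl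
  simp only [divSentence, div, nodes, nodes_inf, nodes_app₃, h₂]
  omega

section ProofLength

variable {L : FirstOrder.Language.{u, v}} {T : L.Theory} {σ : L.Sentence}

theorem proofLength_le (d : Proof T σ) : proofLength T σ ≤ d.size := Nat.sInf_le ⟨d, rfl⟩

theorem Provable.exists_size_eq (h : Provable T σ) : ∃ d : Proof T σ, d.size = proofLength T σ :=
  Nat.sInf_mem (s := {s | ∃ d : Proof T σ, d.size = s}) (h.elim fun d => ⟨_, d, rfl⟩)

theorem Provable.sentenceSize_le (h : Provable T σ) : sentenceSize σ ≤ proofLength T σ := by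
  obtain ⟨d, hd⟩ := h.exists_size_eq
  exact hd ▸ d.formulaSize_le_size

end ProofLength

/-- A polynomial is bounded by a power of `max 2 (n - 1)`: the base is at least `2`, so that its
powers absorb the coefficients, and its square is at least `n + 1`. -/
theorem exists_eval_le_pow (P : Polynomial ℕ) :
    ∃ K, 0 < K ∧ ∀ n, P.eval n ≤ (max 2 (n - 1)) ^ K := by
  set c := ∑ i ∈ Finset.range (P.natDegree + 1), P.coeff i with hc
  have hP : ∀ n, P.eval n ≤ c * (n + 1) ^ P.natDegree := by
    intro n
    rw [Polynomial.eval_eq_sum_range, hc, Finset.sum_mul]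
    refine Finset.sum_le_sum fun i hi => Nat.mul_le_mul_left _ ?_
    calc n ^ i ≤ (n + 1) ^ i := Nat.pow_le_pow_left n.le_succ i
      _ ≤ (n + 1) ^ P.natDegree :=
        Nat.pow_le_pow_right n.succ_pos (Nat.lt_succ_iff.1 (Finset.mem_range.1 hi))
  refine ⟨c + 2 * P.natDegree + 1, by omega, fun n => ?_⟩
  have hb : 2 ≤ max 2 (n - 1) := le_max_left _ _
  have hn : n + 1 ≤ (max 2 (n - 1)) ^ 2 := by
    rcases le_or_gt n 3 with h | h
    · exact le_trans (by omega) (Nat.pow_le_pow_left hb 2)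
    · have h₁ : n - 1 ≤ max 2 (n - 1) := le_max_right _ _
      have h₂ : n ≤ max 2 (n - 1) + 1 := by omega
      nlinarith
  generalize max 2 (n - 1) = b at hb hn ⊢
  calc P.eval n ≤ c * (n + 1) ^ P.natDegree := hP n
    _ ≤ b ^ c * (b ^ 2) ^ P.natDegree :=
      Nat.mul_le_mul (c.lt_two_pow_self.le.trans (Nat.pow_le_pow_left hb c))
        (Nat.pow_le_pow_left hn _)
    _ = b ^ (c + 2 * P.natDegree) := by rw [← pow_mul, ← pow_add]
    _ ≤ b ^ (c + 2 * P.natDegree + 1) := Nat.pow_le_pow_right (by omega) (Nat.le_succ _)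

/-- A growth rate `2 ^ 2 ^ n` against a polynomial is a speedup of order `2 ^ 2 ^ (t ^ ε)`, if the
small values of `n` are taken care of by the bound `16`. -/
theorem exists_exponent {l a : ℕ → ℕ} (P : Polynomial ℕ) (hl : ∀ n, l n ≤ P.eval n)
    (ha : ∀ n, 2 ^ (2 ^ n - 1) ≤ a n) (ha' : ∀ n, 16 ≤ a n) :
    ∃ ε : ℝ, 0 < ε ∧ ∀ n, (2 : ℝ) ^ ((2 : ℝ) ^ ((l n : ℝ) ^ ε)) ≤ a n := by
  obtain ⟨K, hK, hP⟩ := exists_eval_le_pow P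
  refine ⟨(K : ℝ)⁻¹, by positivity, fun n => ?_⟩
  have hb : 2 ^ 2 ^ max 2 (n - 1) ≤ a n := by
    rcases le_or_gt n 3 with h | h
    · rw [max_eq_left (by omega)]
      exact ha' n
    · rw [max_eq_right (by omega)]
      refine le_trans (Nat.pow_le_pow_right two_pos ?_) (ha n)
      obtain ⟨m, rfl⟩ := Nat.exists_eq_add_of_lt h
      have := Nat.one_le_two_pow (n := 3 + m)
      rw [Nat.add_sub_cancel, pow_succ]
      omega
  have hroot : (l n : ℝ) ^ (K : ℝ)⁻¹ ≤ (max 2 (n - 1) : ℕ) := by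
    rw [Real.rpow_inv_le_iff_of_pos (by positivity) (by positivity) (by positivity),
      Real.rpow_natCast]
    exact_mod_cast (hl n).trans (hP n)
  calc (2 : ℝ) ^ ((2 : ℝ) ^ ((l n : ℝ) ^ (K : ℝ)⁻¹))
      ≤ (2 : ℝ) ^ ((2 : ℝ) ^ ((max 2 (n - 1) : ℕ) : ℝ)) := by
        gcongr <;> norm_num
    _ = ((2 ^ 2 ^ max 2 (n - 1) : ℕ) : ℝ) := by
        rw [Real.rpow_natCast, ← Nat.cast_ofNat (R := ℝ), ← Nat.cast_pow, Real.rpow_natCast,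
          ← Nat.cast_pow]
    _ ≤ a n := by exact_mod_cast hb

end ProofLength

theorem mainTheorem1 :
    (∃ P : Polynomial ℕ, ∀ n : ℕ,
      ∃ d : ProofLength.Proof ProofLength.PrA (ProofLength.divSentence n), d.size ≤ P.eval n) ∧
    (∀ n : ℕ, ProofLength.Provable ProofLength.PrAAlt (ProofLength.divSentence n)) ∧
    (∀ (n : ℕ) (d : ProofLength.Proof ProofLength.PrAAlt (ProofLength.divSentence n)),
      (∃ σ ∈ d.used, 2 ^ (2 ^ n - 1) < ProofLength.sentenceSize σ) ∧
      2 ^ (2 ^ n - 1) < d.size) ∧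
    (∃ ε : ℝ, 0 < ε ∧
      ProofLength.WitnessSpeedup ProofLength.PrA ProofLength.PrAAlt
        (fun t => (2 : ℝ) ^ ((2 : ℝ) ^ (t ^ ε))) ProofLength.divSentence) := by
  open ProofLength in
  obtain ⟨P, hP⟩ := exists_polynomial_bound
  have hlarge : ∀ (n : ℕ) (d : Proof PrAAlt (divSentence n)), 2 ^ (2 ^ n - 1) < d.size := by
    intro n d
    obtain ⟨σ, hσ, hlt⟩ := exists_used_large n d
    exact hlt.trans_le (d.sentenceSize_le_size hσ)
  have hPrA : ∀ n, Provable PrA (divSentence n) := fun n => (hP n).elim fun d _ => ⟨d⟩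
  have hAlt := provable_PrAAlt_divSentence
  refine ⟨⟨P, hP⟩, hAlt, fun n d => ⟨exists_used_large n d, hlarge n d⟩, ?_⟩
  obtain ⟨ε, hε, h⟩ := exists_exponent (l := fun n => proofLength PrA (divSentence n))
    (a := fun n => proofLength PrAAlt (divSentence n)) P
    (fun n => (hP n).elim fun d hd => (proofLength_le d).trans hd)
    (fun n => by
      obtain ⟨d, hd⟩ := (hAlt n).exists_size_eq
      exact hd ▸ (hlarge n d).le)
    -- the sentence itself has at least `16` symbols
    (fun n => le_trans (by omega)
      ((le_sentenceSize_divSentence n).trans (hAlt n).sentenceSize_le))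
  refine ⟨ε, hε, fun n => ⟨hPrA n, hAlt n⟩, ?_, h⟩
  refine Filter.tendsto_atTop_mono (fun n => ?_) Filter.tendsto_id
  exact le_trans (Nat.le_add_right n 16)
    ((le_sentenceSize_divSentence n).trans (hPrA n).sentenceSize_le)
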